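/- Let $d\ge 2$ and $q\in(0,1)$. Let $\Omega=\{0,1\}^{\mathbb Z^d}$ carry the product measure $\mu=\prod_{x}\nu$, where $\nu(0)=q$ and $\nu(1)=1-q$, and let $\mathcal N_x$ be the set of the $2d$ nearest neighbours of $x\in\mathbb Z^d$. For a family of influence classes $\mathcal C_x$ (collections of subsets of $\mathcal N_x$), let $c_x(\omega)=1$ if there is $A\in\mathcal C_x$ with $\omega_y=0$ for all $y\in A$, and $c_x(\omega)=0$ otherwise. Let $\mathcal L$ be the generator on $L^2(\Omega,\mu)$ of the associated kinetically constrained dynamics, i.e. the closure of the operator $f\mapsto\sum_x c_x\,(\nu_x(f)-f)$ on functions depending on finitely many coordinates, where $\nu_x(f)$ is the average of $f$ over $\omega_x$ with respect to $\nu$. With $\mathrm{Var}_x(f)$ the variance of $f$ in the variable $\omega_x$ under $\nu$ (the other variables being held fixed), set $$\mathcal D(f)=\sum_{x\in\mathbb Z^d}\mu\bigl(c_x\,\mathrm{Var}_x(f)\bigr),\qquad \mathrm{gap}(\mathcal L)=\inf_{f\in \mathrm{Dom}(\mathcal L),\ f\ne\mathrm{const}}\frac{\mathcal D(f)}{\mathrm{Var}_\mu(f)}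 .$$ Theorem. $\mathrm{gap}(\mathcal L)>0$ for each of the following models on $\mathbb Z^d$: (i) the Fredrickson–Andersen model FA-$j$f, for every $1\le j\le d$, where $\mathcal C_x=\{A\subset\mathcal N_x:\ |A|\ge j\}$ (at least $j$ nearest neighbours of $x$ are $0$); (ii) the Modified Basic model, where $\mathcal C_x=\{A\subset\mathcal N_x:\ A\cap\{x-\vec e_i,x+\vec e_i\}\ne\emptyset\ \text{for all } i=1,\dots,d\}$ (in each coordinate direction at least one of the two neighbours of $x$ is $0$). -/

import Mathlib

open MeasureTheory ProbabilityTheory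
open scoped ENNReal

namespace KCSM

/-- The sites of `ℤ^d`. -/
abbrev Site (d : ℕ) : Type := Fin d → ℤ

/-- Configurations in `{0,1}^{ℤ^d}`; the value `0` (empty) is the good state. -/
abbrev Config (d : ℕ) : Type := Site d → Fin 2

/-- The single-site measure `ν` on `{0,1}`, with `ν {0} = q` and `ν {1} = 1 - q`. -/
noncomputable abbrev siteMeasure (q : unitInterval) : Measure (Fin 2) :=
  bernoulliMeasure 0 1 q

/-- The product measure `μ = ∏ ν` on configurations. -/
noncomputable abbrev configMeasure (d : ℕ) (q : unitInterval) : Measure (Config d) :=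
  Measure.infinitePi fun _ : Site d => siteMeasure q

/-- The real Hilbert space `L²(Ω, μ)`. -/
abbrev L2 (d : ℕ) (q : unitInterval) : Type := Lp ℝ 2 (configMeasure d q)

/-- A family of influence classes: to every site, a collection of finite sets of sites. -/
abbrev InfluenceClasses (d : ℕ) : Type := Site d → Set (Finset (Site d))

/-- The event that the constraint at `x` is satisfied: some set of the influence class of `x` is
entirely empty. -/
def constraintEvent {d : ℕ} (C : InfluenceClasses d) (x : Site d) : Set (Config d) :=
  {ω | ∃ A ∈ C x, ∀ y ∈ A, ω y = 0}

/-- The constraint `c_x` as a `0`-`1` valued function. -/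
noncomputable def constraint {d : ℕ} (C : InfluenceClasses d) (x : Site d) : Config d → ℝ :=
  (constraintEvent C x).indicator 1

/-- Functions that depend on the values at finitely many sites only. -/
def IsLocal {d : ℕ} (F : Config d → ℝ) : Prop :=
  ∃ Λ : Finset (Site d), DependsOn F (Λ : Set (Site d))

/-- The contribution of the site `x` to the generator: `c_x (ν_x(F) - F)`. -/
noncomputable def siteGenerator {d : ℕ} (C : InfluenceClasses d) (q : unitInterval)
    (F : Config d → ℝ) (x : Site d) (ω : Config d) : ℝ :=
  constraint C x ω * ((∫ s, F (Function.update ω x s) ∂(siteMeasure q)) - F ω)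

/-- The generator on local functions, `∑_x c_x (ν_x(F) - F)`; for local `F` the sum has finitely
many nonzero terms. -/
noncomputable def localGenerator {d : ℕ} (C : InfluenceClasses d) (q : unitInterval)
    (F : Config d → ℝ) (ω : Config d) : ℝ :=
  ∑ᶠ x, siteGenerator C q F x ω

section LocalGenerator

variable {d : ℕ} (C : InfluenceClasses d) (q : unitInterval)

lemma finite_support_siteGenerator {F : Config d → ℝ} (hF : IsLocal F) (ω : Config d) :
    (Function.support fun x => siteGenerator C q F x ω).Finite := by
  obtain ⟨Λ, hΛ⟩ := hF
  refine Λ.finite_toSet.subset fun x hx => ?_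
  by_contra hxΛ
  refine hx ?_
  have h : ∀ s, F (Function.update ω x s) = F ω := fun s => hΛ fun i hi => by
    rw [Function.update_of_ne]
    rintro rfl
    exact hxΛ hi
  simp [siteGenerator, h]

lemma IsLocal.add {F G : Config d → ℝ} (hF : IsLocal F) (hG : IsLocal G) : IsLocal (F + G) := by
  classical
  obtain ⟨Λ, hΛ⟩ := hF
  obtain ⟨Λ', hΛ'⟩ := hG
  refine ⟨Λ ∪ Λ', fun x y h => ?_⟩
  rw [Pi.add_apply, Pi.add_apply, hΛ fun i hi => h i (by simp_all),
    hΛ' fun i hi => h i (by simp_all)]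

lemma IsLocal.smul {F : Config d → ℝ} (a : ℝ) (hF : IsLocal F) : IsLocal (a • F) := by
  obtain ⟨Λ, hΛ⟩ := hF
  exact ⟨Λ, fun x y h => by rw [Pi.smul_apply, Pi.smul_apply, hΛ h]⟩

lemma localGenerator_zero : localGenerator C q (0 : Config d → ℝ) = 0 := by
  funext ω
  simp [localGenerator, siteGenerator]

lemma localGenerator_add {F G : Config d → ℝ} (hF : IsLocal F) (hG : IsLocal G) :
    localGenerator C q (F + G) = localGenerator C q F + localGenerator C q G := by
  funext ω
  rw [Pi.add_apply, localGenerator, localGenerator, localGenerator,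
    ← finsum_add_distrib (finite_support_siteGenerator C q hF ω)
      (finite_support_siteGenerator C q hG ω)]
  refine finsum_congr fun x => ?_
  simp only [siteGenerator, Pi.add_apply]
  rw [integral_add Integrable.of_finite Integrable.of_finite]
  ring

lemma localGenerator_smul (a : ℝ) (F : Config d → ℝ) :
    localGenerator C q (a • F) = a • localGenerator C q F := by
  funext ω
  rw [Pi.smul_apply, localGenerator, localGenerator, smul_finsum]
  refine finsum_congr fun x => ?_
  simp only [siteGenerator, Pi.smul_apply, smul_eq_mul]
  rw [integral_const_mul]
  ring

end LocalGenerator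

/-- The graph, in `L²(μ) × L²(μ)`, of the generator acting on local functions. -/
noncomputable def localGraph {d : ℕ} (C : InfluenceClasses d) (q : unitInterval) :
    Submodule ℝ (L2 d q × L2 d q) where
  carrier := {p | ∃ F : Config d → ℝ, IsLocal F ∧ p.1 =ᵐ[configMeasure d q] F ∧
    p.2 =ᵐ[configMeasure d q] localGenerator C q F}
  zero_mem' := by
    refine ⟨0, ⟨∅, fun _ _ _ => rfl⟩, Lp.coeFn_zero ℝ 2 _, ?_⟩
    rw [localGenerator_zero]
    exact Lp.coeFn_zero ℝ 2 _
  add_mem' := by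
    rintro p r ⟨F, hF, hp1, hp2⟩ ⟨G, hG, hr1, hr2⟩
    refine ⟨F + G, hF.add hG, (Lp.coeFn_add p.1 r.1).trans (hp1.add hr1), ?_⟩
    rw [localGenerator_add C q hF hG]
    exact (Lp.coeFn_add p.2 r.2).trans (hp2.add hr2)
  smul_mem' := by
    rintro a p ⟨F, hF, hp1, hp2⟩
    refine ⟨a • F, hF.smul a, (Lp.coeFn_smul a p.1).trans (hp1.const_smul a), ?_⟩
    rw [localGenerator_smul]
    exact (Lp.coeFn_smul a p.2).trans (hp2.const_smul a)

/-- The generator `𝓛` on `L²(μ)`: the operator whose graph is the closure of the graph of the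
generator on local functions. -/
noncomputable def generator {d : ℕ} (C : InfluenceClasses d) (q : unitInterval) :
    L2 d q →ₗ.[ℝ] L2 d q :=
  (localGraph C q).topologicalClosure.toLinearPMap

/-- The local variance `Var_x(f)`, the variance in the variable `ω_x` under `ν`, with the other
variables held fixed. -/
noncomputable def localVar {d : ℕ} (q : unitInterval) (f : Config d → ℝ) (x : Site d)
    (ω : Config d) : ℝ≥0∞ :=
  eVar[fun s => f (Function.update ω x s); siteMeasure q]

/-- The Dirichlet form `𝓓(f) = ∑_x μ(c_x Var_x(f))`. -/
noncomputable def dirichletForm {d : ℕ} (C : InfluenceClasses d) (q : unitInterval)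
    (f : Config d → ℝ) : ℝ≥0∞ :=
  ∑' x : Site d, ∫⁻ ω in constraintEvent C x, localVar q f x ω ∂(configMeasure d q)

/-- The spectral gap: the infimum of `𝓓(f) / Var(f)` over the non-constant `f` in the domain of
the generator. -/
noncomputable def spectralGap {d : ℕ} (C : InfluenceClasses d) (q : unitInterval) : ℝ≥0∞ :=
  ⨅ f : {f : L2 d q // f ∈ (generator C q).domain ∧
      ¬ ∃ c : ℝ, f =ᵐ[configMeasure d q] fun _ => c},
    dirichletForm C q f.1 / eVar[f.1; configMeasure d q]

/-- The nearest neighbours of `x`, the sites at `ℓ¹` distance `1`. -/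
def neighbors {d : ℕ} (x : Site d) : Set (Site d) :=
  {y | ∑ i, |x i - y i| = 1}

/-- The FA-jf model: sets of at least `j` nearest neighbours. -/
def fredricksonAndersen (d j : ℕ) : InfluenceClasses d := fun x =>
  {A | (A : Set (Site d)) ⊆ neighbors x ∧ j ≤ A.card}

/-- The Modified Basic model: sets of nearest neighbours of `x` that contain, in each of the `d`
coordinate directions, at least one of the two neighbours of `x`. -/
def modifiedBasic (d : ℕ) : InfluenceClasses d := fun x =>
  {A | (A : Set (Site d)) ⊆ neighbors x ∧
    ∀ i : Fin d, x - Pi.single i 1 ∈ A ∨ x + Pi.single i 1 ∈ A}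

end KCSM

/-! The result rests on a Poincaré inequality for local functions in the modified basic model. Every
FA-`j`f constraint with `j ≤ d` is weaker, since a set meeting all `d` directions has at least `d`
points, so its energy is larger.

For that inequality, replace the nearest-neighbour constraint at `x` by a long-range one: the sites
`x + e_i` can all be emptied by bootstrap dynamics inside a large cube with lowest corner `x`,
without using `x`. This event depends only on sites that follow `x` lexicographically. Decompose the
variance into martingale increments along the lexicographic order and split each increment according
to the long-range constraint. The good part is bounded by the constrained energy. Cauchy–Schwarz
bounds the bad part by the failure probability times the increments at `x` and in its cube. If the
failure probability is small compared with the inverse volume of the cube, the bad parts sum to at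
most half the variance and can be absorbed (`SelfAdjointOn.poincare`).

Rare failure is bootstrap percolation (`fastDecay`), by induction on the set of active directions.
An emptied cube grows by one layer as soon as the adjacent face, where one direction has become
free, is internally spanned in the remaining directions. Faces are spanned with overwhelming
probability by induction, so an emptied nucleus grows from side `n` to `n²`. Hence spanning has
probability bounded below at all large scales, and many disjoint attempts make failure smaller than
any power of the side.

Where the long-range constraint holds, a path of legal updates carries a flip at `x`, so its energy
is bounded by the true one (`avgSet_emptiedEvent_le`). The inequality then passes from local
functions to the domain of the closed generator by taking limits along the graph
(`spectralGap_pos_of_local`). -/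

namespace KCSM

/-! ### Abstract Poincaré inequality for oriented constraints -/

/-- A commuting family of orthogonal projections indexed by finite sets, on a real vector space with
a positive semidefinite symmetric form. -/
structure ProjectionFamily (ι V : Type*) [DecidableEq ι] [AddCommGroup V] [Module ℝ V] where
  form : V →ₗ[ℝ] V →ₗ[ℝ] ℝ
  symm : ∀ u v, form u v = form v u
  nonneg : ∀ u, 0 ≤ form u u
  proj : Finset ι → Module.End ℝ V
  proj_empty : proj ∅ = 1
  proj_mul : ∀ S T, proj S * proj T = proj (S ∪ T)

namespace ProjectionFamily

variable {ι V : Type*} [DecidableEq ι] [AddCommGroup V] [Module ℝ V] (P : ProjectionFamily ι V)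

/-- The squared seminorm. -/
def normSq (v : V) : ℝ := P.form v v

/-- The complementary projection of a single index. -/
def compl (x : ι) : Module.End ℝ V := 1 - P.proj {x}

/-- The projections indexed by subsets of `Λ` are self-adjoint. -/
def SelfAdjointOn (Λ : Finset ι) : Prop :=
  ∀ S ⊆ Λ, ∀ u v, P.form (P.proj S u) v = P.form u (P.proj S v)

lemma normSq_nonneg (v : V) : 0 ≤ P.normSq v := P.nonneg v

lemma normSq_add_le (u v : V) : P.normSq (u + v) ≤ 2 * P.normSq u + 2 * P.normSq v := by
  have h := P.nonneg (u - v)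
  simp only [map_sub, LinearMap.sub_apply] at h
  simp only [normSq, map_add, LinearMap.add_apply]
  linarith [P.symm u v]

lemma proj_proj (S T : Finset ι) (v : V) : P.proj S (P.proj T v) = P.proj (S ∪ T) v := by
  rw [← P.proj_mul]; rfl

lemma commute_proj (S T : Finset ι) : Commute (P.proj S) (P.proj T) := by
  rw [Commute, SemiconjBy, P.proj_mul, P.proj_mul, Finset.union_comm]

lemma commute_compl_proj (x : ι) (T : Finset ι) : Commute (P.compl x) (P.proj T) :=
  (Commute.one_left _).sub_left (P.commute_proj _ _)

lemma commute_compl_compl (x y : ι) : Commute (P.compl x) (P.compl y) :=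
  (Commute.one_right _).sub_right (P.commute_compl_proj _ _)

lemma compl_proj (x : ι) (T : Finset ι) (v : V) :
    P.compl x (P.proj T v) = P.proj T (P.compl x v) :=
  congrArg (· v) (P.commute_compl_proj x T).eq

lemma compl_compl_comm (x y : ι) (v : V) :
    P.compl x (P.compl y v) = P.compl y (P.compl x v) :=
  congrArg (· v) (P.commute_compl_compl x y).eq

lemma proj_compl_of_mem {x : ι} {T : Finset ι} (hx : x ∈ T) (v : V) :
    P.proj T (P.compl x v) = 0 := by
  simp only [compl, LinearMap.sub_apply, Module.End.one_apply, map_sub, proj_proj]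
  rw [Finset.union_eq_left.2 (by simpa using hx), sub_self]

variable {P} {Λ : Finset ι} (hP : P.SelfAdjointOn Λ)
include hP

lemma SelfAdjointOn.normSq_eq_add {S : Finset ι} (hS : S ⊆ Λ) (v : V) :
    P.normSq v = P.normSq (P.proj S v) + P.normSq (v - P.proj S v) := by
  have h : P.form (P.proj S v) (P.proj S v) = P.form v (P.proj S v) := by
    rw [hP S hS, proj_proj, Finset.union_self]
  simp only [normSq, map_sub, LinearMap.sub_apply]
  linarith [P.symm v (P.proj S v)]

lemma SelfAdjointOn.normSq_proj_le {S : Finset ι} (hS : S ⊆ Λ) (v : V) :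
    P.normSq (P.proj S v) ≤ P.normSq v := by
  linarith [hP.normSq_eq_add hS v, P.normSq_nonneg (v - P.proj S v)]

lemma SelfAdjointOn.normSq_compl_le {x : ι} (hx : x ∈ Λ) (v : V) :
    P.normSq (P.compl x v) ≤ P.normSq v := by
  have := hP.normSq_eq_add (S := {x}) (by simpa using hx) v
  simp only [compl, LinearMap.sub_apply, Module.End.one_apply]
  linarith [P.normSq_nonneg (P.proj {x} v)]

variable {K : Type*} [LinearOrder K] {key : ι → K} (hkey : Function.Injective key)
include hkey

/-- The martingale decomposition of the variance along an order of the indices. -/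
lemma SelfAdjointOn.normSq_eq_sum {S : Finset ι} (hS : S ⊆ Λ) (v : V) :
    P.normSq v = P.normSq (P.proj S v) +
      ∑ z ∈ S, P.normSq (P.compl z (P.proj {w ∈ S | key z < key w} v)) := by
  -- Adding indices in decreasing order leaves the earlier terms unchanged: the new index is the
  -- smallest, so no set of larger indices acquires it.
  induction S using Finset.induction_on_min_value key with
  | empty => simp [P.proj_empty]
  | insert a s ha hle ih =>
    have hlt : ∀ x ∈ s, key a < key x := fun x hx =>
      lt_of_le_of_ne (hle x hx) fun h => ha (hkey h ▸ hx)
    have haΛ : {a} ⊆ Λ := by simpa using hS (Finset.mem_insert_self a s)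
    rw [ih fun x hx => hS (Finset.mem_insert_of_mem hx), Finset.sum_insert ha,
      hP.normSq_eq_add haΛ (P.proj s v), proj_proj, ← Finset.insert_eq, add_assoc]
    have h1 : {w ∈ insert a s | key a < key w} = s := by
      ext w
      simp only [Finset.mem_filter, Finset.mem_insert]
      constructor
      · rintro ⟨rfl | h, h'⟩
        · exact absurd h' (lt_irrefl _)
        · exact h
      · exact fun h => ⟨Or.inr h, hlt w h⟩
    congr 1
    congr 1
    · rw [h1]
      simp [compl, proj_proj]
    · refine Finset.sum_congr rfl fun z hz => ?_
      rw [Finset.filter_insert, if_neg (hlt z hz).not_gt]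

/-- One step of the recursion for the terms of the martingale decomposition, when the constraint
`1 - M` at `x` is independent of `x` and of the indices preceding it, and fails rarely. -/
lemma SelfAdjointOn.normSq_term_le {x : ι} (hx : x ∈ Λ) {Δ : Finset ι} (hΔ : Δ ⊆ Λ)
    (hxΔ : ∀ z ∈ Δ, key x < key z) {M : Module.End ℝ V}
    (hM : ∀ T, Disjoint T Δ → Commute M (P.proj T)) {ε : ℝ}
    (hε : ∀ u, P.normSq (P.proj {w ∈ Λ | key x < key w} (M u)) ≤ ε * P.normSq u) (hε0 : 0 ≤ ε)
    (v : V) :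
    P.normSq (P.compl x (P.proj {w ∈ Λ | key x < key w} v)) ≤
      2 * P.normSq (P.compl x v - M (P.compl x v)) +
      2 * ε * ∑ z ∈ insert x Δ, P.normSq (P.compl z (P.proj {w ∈ Λ | key z < key w} v)) := by
  set G := {w ∈ Λ | key x < key w} with hG
  have hGΛ : G ⊆ Λ := Finset.filter_subset _ _
  set u := P.compl x v with hu
  set h := P.proj (G \ Δ) u with hh
  -- `M` commutes with averaging outside `Δ`, so under the average over `G` the function `u` may be
  -- replaced by `h`, already averaged over `G \ Δ`. The bad part thus sees only the fluctuations of
  -- `v` near `x`.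
  have hcomm : P.proj G (M u) = P.proj G (M h) := by
    have h1 : M h = P.proj (G \ Δ) (M u) :=
      congrArg (· u) (hM (G \ Δ) Finset.sdiff_disjoint).eq
    rw [h1, proj_proj, Finset.union_eq_left.2 Finset.sdiff_subset]
  have hsplit : P.compl x (P.proj G v) = P.proj G (u - M u) + P.proj G (M h) := by
    rw [compl_proj, ← hcomm, ← map_add, sub_add_cancel]
  have hins : insert x Δ ⊆ Λ := Finset.insert_subset hx hΔ
  have hsum : P.normSq h ≤
      ∑ z ∈ insert x Δ, P.normSq (P.compl z (P.proj {w ∈ Λ | key z < key w} v)) := by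
    rw [hP.normSq_eq_sum hkey hins h]
    -- `u` has zero average at `x`, so `h` consists only of its increments over `insert x Δ`.
    have h0 : P.proj (insert x Δ) h = 0 := by
      rw [hh, proj_proj, hu, proj_compl_of_mem _ (by simp)]
    have h00 : P.normSq 0 = 0 := by simp [normSq]
    rw [h0, h00, zero_add]
    refine Finset.sum_le_sum fun z hz => ?_
    set U := {w ∈ insert x Δ | key z < key w} ∪ G \ Δ with hU
    have hUΛ : U ⊆ Λ := Finset.union_subset ((Finset.filter_subset _ _).trans hins)
      (Finset.sdiff_subset.trans hGΛ)
    have hxz : key x ≤ key z := by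
      rcases Finset.mem_insert.1 hz with rfl | hz
      · exact le_rfl
      · exact (hxΔ z hz).le
    have hsup : {w ∈ Λ | key z < key w} ⊆ U := by
      intro w hw
      simp only [hU, hG, Finset.mem_union, Finset.mem_filter, Finset.mem_insert,
        Finset.mem_sdiff] at hw ⊢
      by_cases hwΔ : w ∈ Δ
      · exact Or.inl ⟨Or.inr hwΔ, hw.2⟩
      · exact Or.inr ⟨⟨hw.1, hxz.trans_lt hw.2⟩, hwΔ⟩
    -- Each increment of `h` is a contraction of the increment of `v` at the same `z`: all the
    -- operators commute, and `U` already contains every index of `Λ` after `z`.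
    have hterm : P.compl z (P.proj {w ∈ insert x Δ | key z < key w} h) =
        P.compl x (P.proj U (P.compl z (P.proj {w ∈ Λ | key z < key w} v))) := by
      rw [hh, proj_proj, ← hU, hu, P.compl_proj z {w ∈ Λ | key z < key w}, proj_proj,
        Finset.union_eq_left.2 hsup, compl_proj, compl_proj, compl_compl_comm]
    rw [hterm]
    exact (hP.normSq_compl_le hx _).trans (hP.normSq_proj_le hUΛ _)
  rw [hsplit]
  refine (P.normSq_add_le _ _).trans ?_
  have h1 := hP.normSq_proj_le hGΛ (u - M u)
  have h2 := (hε h).trans (mul_le_mul_of_nonneg_left hsum hε0)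
  linarith

/-- Poincaré inequality with rarely failing oriented constraints. -/
theorem SelfAdjointOn.poincare {Λ₀ : Finset ι} (hΛ₀ : Λ₀ ⊆ Λ) {Δ : ι → Finset ι}
    (hΔ : ∀ x ∈ Λ₀, Δ x ⊆ Λ) (hxΔ : ∀ x, ∀ z ∈ Δ x, key x < key z) {M : ι → Module.End ℝ V}
    (hM : ∀ x T, Disjoint T (Δ x) → Commute (M x) (P.proj T)) {ε : ℝ} (hε0 : 0 ≤ ε)
    (hε : ∀ x ∈ Λ₀, ∀ u,
      P.normSq (P.proj {w ∈ Λ | key x < key w} (M x u)) ≤ ε * P.normSq u)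
    {m : ℕ} (hm : ∀ z, ∀ T : Finset ι, (∀ x ∈ T, z ∈ insert x (Δ x)) → T.card ≤ m)
    (hεm : ε * m ≤ 1 / 4) {v : V} (hv : ∀ x ∈ Λ, x ∉ Λ₀ → P.compl x v = 0) :
    P.normSq (v - P.proj Λ v) ≤
      4 * ∑ x ∈ Λ₀, P.normSq (P.compl x v - M x (P.compl x v)) := by
  set a : ι → ℝ := fun z => P.normSq (P.compl z (P.proj {w ∈ Λ | key z < key w} v)) with ha
  have ha0 : ∀ z, 0 ≤ a z := fun z => P.normSq_nonneg _
  have hvar : P.normSq (v - P.proj Λ v) = ∑ z ∈ Λ, a z := by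
    linarith [hP.normSq_eq_add subset_rfl v, hP.normSq_eq_sum hkey subset_rfl v]
  have hsub : ∑ z ∈ Λ, a z = ∑ z ∈ Λ₀, a z := by
    refine (Finset.sum_subset hΛ₀ fun z hz hz0 => ?_).symm
    simp only [ha, compl_proj, hv z hz hz0, map_zero]
    simp [normSq]
  have hstep : ∑ x ∈ Λ₀, a x ≤ ∑ x ∈ Λ₀,
      (2 * P.normSq (P.compl x v - M x (P.compl x v)) + 2 * ε * ∑ z ∈ insert x (Δ x), a z) :=
    Finset.sum_le_sum fun x hx =>
      hP.normSq_term_le hkey (hΛ₀ hx) (hΔ x hx) (hxΔ x) (hM x) (hε x hx) hε0 v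
  rw [Finset.sum_add_distrib, ← Finset.mul_sum, ← Finset.mul_sum] at hstep
  -- Exchanging the sums, each increment is charged by at most `m` sites.
  have hcount : ∑ x ∈ Λ₀, ∑ z ∈ insert x (Δ x), a z ≤ m * ∑ z ∈ Λ, a z := by
    rw [Finset.sum_comm' (s' := fun z => {x ∈ Λ₀ | z ∈ insert x (Δ x)}) (t' := Λ)]
    · rw [Finset.mul_sum]
      refine Finset.sum_le_sum fun z _ => ?_
      rw [Finset.sum_const, nsmul_eq_mul]
      refine mul_le_mul_of_nonneg_right ?_ (ha0 z)
      exact_mod_cast hm z _ fun x hx => (Finset.mem_filter.1 hx).2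
    · intro x z
      simp only [Finset.mem_filter]
      constructor
      · rintro ⟨hx, hz⟩
        exact ⟨⟨hx, hz⟩, Finset.insert_subset (hΛ₀ hx) (hΔ x hx) hz⟩
      · rintro ⟨⟨hx, hz⟩, _⟩
        exact ⟨hx, hz⟩
  have hA : 0 ≤ ∑ z ∈ Λ, a z := Finset.sum_nonneg fun z _ => ha0 z
  have h1 := mul_le_mul_of_nonneg_left hcount hε0
  have h2 := mul_le_mul_of_nonneg_right hεm hA
  rw [hvar]
  rw [← hsub] at hstep
  -- With `A` the variance and `S` the constrained energy, `A ≤ 2 S + 2 ε m A ≤ 2 S + A / 2`, whence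
  -- the constant `4`.
  nlinarith

end ProjectionFamily

end KCSM

/-! ### Single-site averages as commuting projections -/

namespace KCSM

section Averaging

variable {d : ℕ}

/-- The average over the value at the site `x`, with weight `p` on the value `0`. -/
def avg (p : ℝ) (x : Site d) : Module.End ℝ (Config d → ℝ) where
  toFun f ω := p * f (Function.update ω x 0) + (1 - p) * f (Function.update ω x 1)
  map_add' f g := by
    funext ω
    simp only [Pi.add_apply]
    ring
  map_smul' a f := by
    funext ω
    simp only [Pi.smul_apply, smul_eq_mul, RingHom.id_apply]
    ring

lemma avg_apply (p : ℝ) (x : Site d) (f : Config d → ℝ) (ω : Config d) :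
    avg p x f ω = p * f (Function.update ω x 0) + (1 - p) * f (Function.update ω x 1) := rfl

lemma avg_update (p : ℝ) (x : Site d) (f : Config d → ℝ) (ω : Config d) (v : Fin 2) :
    avg p x f (Function.update ω x v) = avg p x f ω := by
  simp [avg_apply]

lemma commute_avg (p : ℝ) (x y : Site d) : Commute (avg p x) (avg p y) := by
  rcases eq_or_ne x y with rfl | h
  · exact Commute.refl _
  · ext f ω
    simp only [Module.End.mul_apply, avg_apply, Function.update_comm h]
    ring

lemma avg_mul_self (p : ℝ) (x : Site d) : avg p x * avg p x = avg p x := by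
  ext f ω
  simp only [Module.End.mul_apply, avg_apply, Function.update_idem]
  ring

/-- The average over the values at the sites of a finite set. -/
def avgSet (p : ℝ) (S : Finset (Site d)) : Module.End ℝ (Config d → ℝ) :=
  S.noncommProd (avg p) fun _ _ _ _ _ => commute_avg p _ _

variable {p : ℝ}

@[simp] lemma avgSet_empty : avgSet p (∅ : Finset (Site d)) = 1 := rfl

@[simp] lemma avgSet_singleton (x : Site d) : avgSet p {x} = avg p x :=
  Finset.noncommProd_singleton _ _

lemma avg_mul_avgSet (x : Site d) (S : Finset (Site d)) :
    avg p x * avgSet p S = avgSet p (insert x S) := by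
  have key : ∀ T : Finset (Site d), x ∉ T → avg p x * avgSet p T = avgSet p (insert x T) :=
    fun T hT => (Finset.noncommProd_insert_of_notMem T x _ _ hT).symm
  by_cases hx : x ∈ S
  · rw [Finset.insert_eq_of_mem hx]
    conv_lhs => rw [← Finset.insert_erase hx]
    rw [← key _ (Finset.notMem_erase x S), ← mul_assoc, avg_mul_self,
      key _ (Finset.notMem_erase x S), Finset.insert_erase hx]
  · exact key S hx

lemma avgSet_mul_avgSet (S T : Finset (Site d)) :
    avgSet p S * avgSet p T = avgSet p (S ∪ T) := by
  induction S using Finset.induction_on with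
  | empty => simp
  | insert a S ha ih => rw [← avg_mul_avgSet, mul_assoc, ih, avg_mul_avgSet, Finset.insert_union]

lemma avgSet_avgSet (S T : Finset (Site d)) (f : Config d → ℝ) :
    avgSet p S (avgSet p T f) = avgSet p (S ∪ T) f := by
  rw [← avgSet_mul_avgSet]; rfl

lemma avgSet_insert (x : Site d) (S : Finset (Site d)) (f : Config d → ℝ) :
    avgSet p (insert x S) f = avg p x (avgSet p S f) := by
  rw [← avg_mul_avgSet]; rfl

lemma avgSet_update {S : Finset (Site d)} {x : Site d} (hx : x ∈ S) (f : Config d → ℝ)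
    (ω : Config d) (v : Fin 2) : avgSet p S f (Function.update ω x v) = avgSet p S f ω := by
  rw [← Finset.insert_eq_of_mem hx, avgSet_insert, avg_update]

lemma avgSet_mul_of_forall_update {S : Finset (Site d)} {g : Config d → ℝ}
    (hg : ∀ x ∈ S, ∀ ω v, g (Function.update ω x v) = g ω) (f : Config d → ℝ) :
    avgSet p S (g * f) = g * avgSet p S f := by
  induction S using Finset.induction_on with
  | empty => simp
  | insert a S ha ih =>
    rw [avgSet_insert, avgSet_insert, ih fun x hx => hg x (Finset.mem_insert_of_mem hx)]
    funext ω
    simp only [avg_apply, Pi.mul_apply, hg a (Finset.mem_insert_self a S)]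
    ring

lemma avgSet_mul_of_dependsOn {S : Finset (Site d)} {T : Set (Site d)} {g : Config d → ℝ}
    (hg : DependsOn g T) (hST : ∀ x ∈ S, x ∉ T) (f : Config d → ℝ) :
    avgSet p S (g * f) = g * avgSet p S f :=
  avgSet_mul_of_forall_update (fun x hx ω v => hg fun i hi => by
    rw [Function.update_of_ne]
    rintro rfl
    exact hST _ hx hi) f

lemma avgSet_one (S : Finset (Site d)) : avgSet p S 1 = 1 := by
  induction S using Finset.induction_on with
  | empty => simp
  | insert a S ha ih =>
    rw [avgSet_insert, ih]
    funext ω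
    simp [avg_apply]

lemma avgSet_eq_self {S : Finset (Site d)} {T : Set (Site d)} {g : Config d → ℝ}
    (hg : DependsOn g T) (hST : ∀ x ∈ S, x ∉ T) : avgSet p S g = g := by
  simpa [avgSet_one] using avgSet_mul_of_dependsOn (p := p) hg hST 1

lemma DependsOn.avgSet {f : Config d → ℝ} {T : Set (Site d)} (hf : DependsOn f T)
    (S : Finset (Site d)) : DependsOn (avgSet p S f) (T \ S) := by
  classical
  induction S using Finset.induction_on with
  | empty => simpa using hf
  | insert a S ha ih =>
    intro ω ω' h
    rw [avgSet_insert, avg_apply, avg_apply]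
    have key : ∀ v, KCSM.avgSet p S f (Function.update ω a v) =
        KCSM.avgSet p S f (Function.update ω' a v) := fun v => ih fun i hi => by
      rcases eq_or_ne i a with rfl | hia
      · simp
      · rw [Function.update_of_ne hia, Function.update_of_ne hia]
        refine h i ⟨hi.1, ?_⟩
        have := hi.2
        simp_all
    rw [key, key]

lemma avgSet_nonneg (hp0 : 0 ≤ p) (hp1 : p ≤ 1) (S : Finset (Site d)) {f : Config d → ℝ}
    (hf : 0 ≤ f) : 0 ≤ avgSet p S f := by
  induction S using Finset.induction_on with
  | empty => simpa using hf
  | insert a S ha ih =>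
    rw [avgSet_insert]
    intro ω
    exact add_nonneg (mul_nonneg hp0 (ih _)) (mul_nonneg (by linarith) (ih _))

lemma avgSet_mono (hp0 : 0 ≤ p) (hp1 : p ≤ 1) (S : Finset (Site d)) {f g : Config d → ℝ}
    (hfg : f ≤ g) : avgSet p S f ≤ avgSet p S g := by
  have := avgSet_nonneg hp0 hp1 S (sub_nonneg.2 hfg)
  rwa [map_sub, sub_nonneg] at this

/-- Cauchy–Schwarz for the conditional expectation, from the discriminant of the nonnegative
quadratic `t ↦ avgSet p S ((t f + g)²)`. -/
lemma avgSet_mul_sq_le (hp0 : 0 ≤ p) (hp1 : p ≤ 1) (S : Finset (Site d)) (f g : Config d → ℝ)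
    (ω : Config d) :
    avgSet p S (f * g) ω ^ 2 ≤ avgSet p S (f * f) ω * avgSet p S (g * g) ω := by
  have h : ∀ t : ℝ, 0 ≤ avgSet p S (f * f) ω * (t * t) + 2 * avgSet p S (f * g) ω * t +
      avgSet p S (g * g) ω := fun t => by
    have h1 : (t • f + g) * (t • f + g) = (t * t) • (f * f) + (2 * t) • (f * g) + g * g := by
      funext ω
      simp only [Pi.mul_apply, Pi.add_apply, Pi.smul_apply, smul_eq_mul]
      ring
    have h2 := avgSet_nonneg hp0 hp1 S (f := (t • f + g) * (t • f + g))
      (fun ω => mul_self_nonneg _) ω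
    rw [h1] at h2
    simp only [map_add, map_smul, Pi.add_apply, Pi.smul_apply, smul_eq_mul, Pi.zero_apply] at h2
    linarith
  have := discrim_le_zero h
  rw [discrim] at this
  nlinarith

/-- The averages as commuting orthogonal projections for the `L²` form of the sites in `Λ`. -/
def avgFamily (hp0 : 0 ≤ p) (hp1 : p ≤ 1) (Λ : Finset (Site d)) :
    ProjectionFamily (Site d) (Config d → ℝ) where
  -- Sites outside `Λ` are frozen at `0`. The freezing is harmless for functions depending only on
  -- `Λ`, whose averages over `Λ` are integrals.
  form := LinearMap.mk₂ ℝ (fun f g => avgSet p Λ (f * g) 0)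
    (fun f g h => by simp [add_mul]) (fun a f g => by simp) (fun f g h => by simp [mul_add])
    (fun a f g => by simp)
  symm f g := by simp [mul_comm]
  nonneg f := avgSet_nonneg hp0 hp1 Λ (f := f * f) (fun ω => mul_self_nonneg _) 0
  proj := avgSet p
  proj_empty := avgSet_empty
  proj_mul := avgSet_mul_avgSet

/-- Averaging over `Λ` includes averaging over `S`, which pulls out a factor already averaged over
`S`. Both sides become the average of the product of the two averaged functions. -/
lemma avgFamily_selfAdjointOn (hp0 : 0 ≤ p) (hp1 : p ≤ 1) (Λ : Finset (Site d)) :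
    (avgFamily hp0 hp1 Λ).SelfAdjointOn Λ := by
  intro S hS f g
  change avgSet p Λ (avgSet p S f * g) 0 = avgSet p Λ (f * avgSet p S g) 0
  rw [← Finset.union_eq_left.2 hS, ← avgSet_avgSet, ← avgSet_avgSet,
    avgSet_mul_of_forall_update (fun x hx ω v => avgSet_update hx f ω v), mul_comm f,
    avgSet_mul_of_forall_update (fun x hx ω v => avgSet_update hx g ω v), mul_comm]

end Averaging

/-! ### Averages and the product measure -/

section Measure

variable {d : ℕ} (q : unitInterval)

lemma integral_siteMeasure (g : Fin 2 → ℝ) :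
    ∫ s, g s ∂(siteMeasure q) = q * g 0 + (1 - q) * g 1 := by
  rw [integral_bernoulliMeasure]
  simp

lemma lintegral_siteMeasure (g : Fin 2 → ℝ≥0∞) :
    ∫⁻ s, g s ∂(siteMeasure q) = ENNReal.ofReal q * g 0 + ENNReal.ofReal (1 - q) * g 1 := by
  have h0 : ENNReal.ofReal (q : ℝ) = (unitInterval.toNNReal q : ℝ≥0∞) := by
    rw [← ENNReal.ofReal_coe_nnreal, unitInterval.coe_toNNReal]
  have h1 : ENNReal.ofReal (1 - q : ℝ) =
      (unitInterval.toNNReal (unitInterval.symm q) : ℝ≥0∞) := by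
    rw [← ENNReal.ofReal_coe_nnreal, unitInterval.coe_toNNReal, unitInterval.coe_symm_eq]
  rw [siteMeasure, bernoulliMeasure_def, lintegral_add_measure, lintegral_smul_measure,
    lintegral_smul_measure, lintegral_dirac, lintegral_dirac, h0, h1]
  rfl

lemma measurable_update_prod (x : Site d) :
    Measurable fun z : Config d × Fin 2 => Function.update z.1 x z.2 := by
  refine measurable_pi_lambda _ fun y => ?_
  rcases eq_or_ne y x with rfl | h
  · simpa using measurable_snd
  · simp only [Function.update_of_ne h]
    exact (measurable_pi_apply y).comp measurable_fst

lemma measurable_update_const (x : Site d) (v : Fin 2) :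
    Measurable fun ω : Config d => Function.update ω x v :=
  (measurable_update_prod x).comp (measurable_id.prodMk measurable_const)

/-- Resampling the value at one site preserves the product measure. -/
lemma map_update_configMeasure (x : Site d) :
    ((configMeasure d q).prod (siteMeasure q)).map
      (fun z : Config d × Fin 2 => Function.update z.1 x z.2) = configMeasure d q := by
  refine Measure.eq_infinitePi _ fun s t ht => ?_
  rw [Measure.map_apply (measurable_update_prod x)
    (MeasurableSet.pi s.countable_toSet fun i _ => ht i)]
  have hpre : (fun z : Config d × Fin 2 => Function.update z.1 x z.2) ⁻¹' Set.pi s t =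
      Set.pi (s.erase x) t ×ˢ (if x ∈ s then t x else Set.univ) := by
    ext ⟨ω, v⟩
    simp only [Set.mem_preimage, Set.mem_pi, Set.mem_prod, Finset.mem_coe, Finset.mem_erase]
    constructor
    · intro h
      refine ⟨fun i hi => by simpa [Function.update_of_ne hi.1] using h i hi.2, ?_⟩
      split_ifs with hx
      · simpa using h x hx
      · trivial
    · rintro ⟨h1, h2⟩ i hi
      rcases eq_or_ne i x with rfl | hix
      · simpa [hi] using h2
      · simpa [Function.update_of_ne hix] using h1 i ⟨hix, hi⟩
  rw [hpre, Measure.prod_prod, Measure.infinitePi_pi _ fun i _ => ht i]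
  split_ifs with hx
  · rw [mul_comm, Finset.mul_prod_erase s (fun i => siteMeasure q (t i)) hx]
  · rw [Finset.erase_eq_of_notMem hx, measure_univ, mul_one]

lemma lintegral_update (x : Site d) {f : Config d → ℝ≥0∞} (hf : Measurable f) :
    ∫⁻ ω, f ω ∂(configMeasure d q) = ENNReal.ofReal q *
      ∫⁻ ω, f (Function.update ω x 0) ∂(configMeasure d q) + ENNReal.ofReal (1 - q) *
      ∫⁻ ω, f (Function.update ω x 1) ∂(configMeasure d q) := by
  conv_lhs => rw [← map_update_configMeasure q x]
  rw [lintegral_map hf (measurable_update_prod x),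
    lintegral_prod (fun z : Config d × Fin 2 => f (Function.update z.1 x z.2))
      (hf.comp (measurable_update_prod x)).aemeasurable]
  simp only [lintegral_siteMeasure]
  have h : ∀ v, Measurable fun ω : Config d => f (Function.update ω x v) := fun v =>
    hf.comp (measurable_update_const x v)
  rw [lintegral_add_left ((h 0).const_mul _), lintegral_const_mul _ (h 0),
    lintegral_const_mul _ (h 1)]

variable {q}

/-- Resampling at `x` writes the integral of `|f|` as a combination of the integrals of its two
frozen versions with weights `q` and `1 - q`. Both weights are positive, so both integrals are
finite. -/
lemma integrable_update (hq0 : 0 < q) (hq1 : q < 1) (x : Site d) (v : Fin 2) {f : Config d → ℝ}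
    (hf : Measurable f) (hfi : Integrable f (configMeasure d q)) :
    Integrable (fun ω => f (Function.update ω x v)) (configMeasure d q) := by
  refine ⟨(hf.comp (measurable_update_const x v)).aestronglyMeasurable, ?_⟩
  have h := hfi.2
  rw [hasFiniteIntegral_iff_enorm, lintegral_update q x hf.enorm, ENNReal.add_lt_top] at h
  rw [hasFiniteIntegral_iff_enorm]
  have hq0' : (0 : ℝ) < q := hq0
  have hq1' : (q : ℝ) < 1 := hq1
  have key : ∀ r : ℝ, 0 < r → ∀ I : ℝ≥0∞, ENNReal.ofReal r * I < ⊤ → I < ⊤ := by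
    intro r hr I hI
    by_contra hI'
    rw [not_lt, top_le_iff] at hI'
    rw [hI', ENNReal.mul_top (by simpa using hr)] at hI
    exact lt_irrefl _ hI
  fin_cases v
  · exact key _ hq0' _ h.1
  · exact key _ (by linarith) _ h.2

lemma integral_avg (x : Site d) {f : Config d → ℝ}
    (hf : Measurable f) (hfi : Integrable f (configMeasure d q)) :
    ∫ ω, avg q x f ω ∂(configMeasure d q) = ∫ ω, f ω ∂(configMeasure d q) := by
  conv_rhs => rw [← map_update_configMeasure q x]
  have hm := measurable_update_prod x
  have hfi' : Integrable (fun z : Config d × Fin 2 => f (Function.update z.1 x z.2))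
      ((configMeasure d q).prod (siteMeasure q)) := by
    refine (integrable_map_measure hf.aestronglyMeasurable hm.aemeasurable).1 ?_
    rwa [map_update_configMeasure]
  rw [integral_map hm.aemeasurable hf.aestronglyMeasurable, integral_prod _ hfi']
  simp only [integral_siteMeasure]
  rfl

lemma IsLocal.measurable {f : Config d → ℝ} (hf : IsLocal f) : Measurable f := by
  obtain ⟨Λ, hΛ⟩ := hf
  obtain ⟨g, rfl⟩ := dependsOn_iff_exists_comp.1 hΛ
  exact (measurable_of_finite g).comp (measurable_pi_lambda _ fun a => measurable_pi_apply _)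

lemma IsLocal.exists_bound {f : Config d → ℝ} (hf : IsLocal f) : ∃ C, ∀ ω, ‖f ω‖ ≤ C := by
  obtain ⟨Λ, hΛ⟩ := hf
  obtain ⟨g, rfl⟩ := dependsOn_iff_exists_comp.1 hΛ
  obtain ⟨C, hC⟩ := (Set.finite_range fun z => ‖g z‖).bddAbove
  exact ⟨C, fun ω => hC ⟨_, rfl⟩⟩

lemma IsLocal.memLp {f : Config d → ℝ} (hf : IsLocal f) (r : ℝ≥0∞) :
    MemLp f r (configMeasure d q) := by
  obtain ⟨C, hC⟩ := hf.exists_bound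
  exact MemLp.of_bound hf.measurable.aestronglyMeasurable C (Filter.Eventually.of_forall hC)

lemma IsLocal.integrable {f : Config d → ℝ} (hf : IsLocal f) :
    Integrable f (configMeasure d q) :=
  memLp_one_iff_integrable.1 (hf.memLp 1)

lemma IsLocal.avgSet {f : Config d → ℝ} (hf : IsLocal f) (p : ℝ) (S : Finset (Site d)) :
    IsLocal (avgSet p S f) := by
  obtain ⟨Λ, hΛ⟩ := hf
  exact ⟨Λ, (DependsOn.avgSet hΛ S).mono Set.sdiff_subset⟩

lemma integral_avgSet (S : Finset (Site d)) {f : Config d → ℝ}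
    (hf : IsLocal f) :
    ∫ ω, avgSet q S f ω ∂(configMeasure d q) = ∫ ω, f ω ∂(configMeasure d q) := by
  induction S using Finset.induction_on with
  | empty => simp
  | insert a S ha ih =>
    rw [avgSet_insert, integral_avg _ (hf.avgSet _ _).measurable (hf.avgSet _ _).integrable,
      ih]

/-- Averaging over all the sites a function depends on is integrating it. -/
lemma avgSet_eq_integral {S T : Finset (Site d)} (hST : S ⊆ T)
    {f : Config d → ℝ} (hf : DependsOn f (S : Set (Site d))) (ω : Config d) :
    avgSet q T f ω = ∫ ω, f ω ∂(configMeasure d q) := by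
  have h : ∀ ω', avgSet q T f ω' = avgSet q T f ω := fun ω' =>
    DependsOn.avgSet hf T fun i hi => absurd (hST hi.1) hi.2
  rw [← integral_avgSet T ⟨S, hf⟩]
  simp [h]

end Measure

end KCSM

/-! ### Bootstrap dynamics and paths of legal updates -/

namespace KCSM

variable {d : ℕ}

/-- The sites of `U` that can be emptied by the bootstrap dynamics inside `U` which empties a site
as soon as, in every direction of `I`, one of its two neighbours is empty. -/
inductive Emptied (I : Finset (Fin d)) (U : Set (Site d)) (ω : Config d) : Site d → Prop
  | of_eq_zero {y : Site d} (hy : y ∈ U) (h : ω y = 0) : Emptied I U ω y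
  | step {y : Site d} (hy : y ∈ U) (s : Fin d → ℤ) (hs : ∀ i, s i = -1 ∨ s i = 1)
      (h : ∀ i ∈ I, Emptied I U ω (y + Pi.single i (s i))) : Emptied I U ω y

lemma Emptied.mem {I : Finset (Fin d)} {U : Set (Site d)} {ω : Config d} {y : Site d}
    (h : Emptied I U ω y) : y ∈ U := by
  cases h <;> assumption

lemma Emptied.mono {I : Finset (Fin d)} {U U' : Set (Site d)} (hU : U ⊆ U') {ω ω' : Config d}
    (hω : ∀ y ∈ U, ω y = 0 → ω' y = 0) {y : Site d} (h : Emptied I U ω y) :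
    Emptied I U' ω' y := by
  induction h with
  | of_eq_zero hy h => exact .of_eq_zero (hU hy) (hω _ hy h)
  | step hy s hs _ ih => exact .step (hU hy) s hs ih

/-- The difference of the values of `f` at the two states of the site `x`. -/
def grad (x : Site d) (f : Config d → ℝ) (ω : Config d) : ℝ :=
  f (Function.update ω x 1) - f (Function.update ω x 0)

lemma abs_update_zero_sub_le (y : Site d) (f : Config d → ℝ) (ω : Config d) :
    |f (Function.update ω y 0) - f ω| ≤ |grad y f ω| := by
  have h : ω y = 0 ∨ ω y = 1 := by omega
  rcases h with h | h
  · rw [← h, Function.update_eq_self, sub_self, abs_zero]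
    exact abs_nonneg _
  · rw [grad, ← h, Function.update_eq_self, abs_sub_comm]

lemma mem_constraintEvent_modifiedBasic {y : Site d} {ω : Config d} {s : Fin d → ℤ}
    (hs : ∀ i, s i = -1 ∨ s i = 1) (h : ∀ i, ω (y + Pi.single i (s i)) = 0) :
    ω ∈ constraintEvent (modifiedBasic d) y := by
  classical
  refine ⟨Finset.univ.image fun i => y + Pi.single i (s i), ⟨?_, fun i => ?_⟩, ?_⟩
  · intro z hz
    obtain ⟨i, -, rfl⟩ := by simpa using hz
    simp only [neighbors, Set.mem_ofPred_eq, Pi.add_apply, sub_add_cancel_left, abs_neg]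
    rw [Finset.sum_eq_single i (fun j _ hj => by simp [hj]) (by simp)]
    rcases hs i with h | h <;> simp [h]
  · rcases hs i with h | h
    · refine Or.inl (Finset.mem_image.2 ⟨i, Finset.mem_univ _, ?_⟩)
      rw [h, Pi.single_neg, sub_eq_add_neg]
    · exact Or.inr (Finset.mem_image.2 ⟨i, Finset.mem_univ _, by rw [h]⟩)
  · intro z hz
    obtain ⟨i, -, rfl⟩ := Finset.mem_image.1 hz
    exact h i

lemma constraint_nonneg (C : InfluenceClasses d) (y : Site d) (ω : Config d) :
    0 ≤ constraint C y ω :=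
  Set.indicator_nonneg (fun _ _ => zero_le_one) ω

lemma constraint_eq_one {C : InfluenceClasses d} {y : Site d} {ω : Config d}
    (h : ω ∈ constraintEvent C y) : constraint C y ω = 1 := by
  simp [constraint, h]

lemma constraint_sq (C : InfluenceClasses d) (y : Site d) (ω : Config d) :
    constraint C y ω ^ 2 = constraint C y ω := by
  by_cases h : ω ∈ constraintEvent C y <;> simp [constraint, h]

/-- The configuration which in `B` is empty exactly on `T`, and agrees with `ω` outside `B`. -/
def refill (B T : Finset (Site d)) (ω : Config d) : Config d :=
  B.piecewise (fun y => if y ∈ T then 0 else 1) ω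

lemma eq_refill {B : Finset (Site d)} {ω ζ : Config d} (h : ∀ y ∉ B, ζ y = ω y) :
    ζ = refill B {y ∈ B | ζ y = 0} ω := by
  funext y
  by_cases hy : y ∈ B
  · simp only [refill, Finset.piecewise_eq_of_mem _ _ _ hy, Finset.mem_filter, hy, true_and]
    split_ifs with h0
    · exact h0
    · omega
  · simp only [refill, Finset.piecewise_eq_of_notMem _ _ _ hy, h y hy]

/-- If the neighbours `x + e_i` can be emptied without using `x`, the variation of `f` at `x` is
controlled by its variations along legal updates. -/
lemma abs_grad_le_sum {U : Finset (Site d)} {x : Site d} (hx : x ∉ U) {ω : Config d}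
    (hω : ∀ i, Emptied Finset.univ U ω (x + Pi.single i 1)) (f : Config d → ℝ) :
    |grad x f ω| ≤ (2 * U.card + 1) * ∑ T ∈ (insert x U).powerset, ∑ y ∈ insert x U,
      constraint (modifiedBasic d) y (refill (insert x U) T ω) *
        |grad y f (refill (insert x U) T ω)| := by
  set B := insert x U with hB
  set G := ∑ T ∈ B.powerset, ∑ y ∈ B,
      constraint (modifiedBasic d) y (refill B T ω) * |grad y f (refill B T ω)| with hG
  have hterm : ∀ T y, 0 ≤ constraint (modifiedBasic d) y (refill B T ω) *
      |grad y f (refill B T ω)| := fun T y =>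
    mul_nonneg (constraint_nonneg _ _ _) (abs_nonneg _)
  have hle : ∀ ζ : Config d, (∀ z ∉ B, ζ z = ω z) → ∀ y ∈ B,
      ζ ∈ constraintEvent (modifiedBasic d) y → |grad y f ζ| ≤ G := by
    intro ζ hζ y hy hc
    have h1 : |grad y f ζ| = constraint (modifiedBasic d) y (refill B {z ∈ B | ζ z = 0} ω) *
        |grad y f (refill B {z ∈ B | ζ z = 0} ω)| := by
      rw [← eq_refill hζ, constraint_eq_one hc, one_mul]
    rw [h1]
    refine (Finset.single_le_sum (f := fun y => constraint (modifiedBasic d) y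
      (refill B {z ∈ B | ζ z = 0} ω) * |grad y f (refill B {z ∈ B | ζ z = 0} ω)|)
      (fun y _ => hterm _ y) hy).trans ?_
    exact Finset.single_le_sum (f := fun T => ∑ y ∈ B, constraint (modifiedBasic d) y
      (refill B T ω) * |grad y f (refill B T ω)|)
      (fun T _ => Finset.sum_nonneg fun y _ => hterm T y)
      (Finset.mem_powerset.2 (Finset.filter_subset _ _))
  have hG0 : 0 ≤ G := Finset.sum_nonneg fun T _ => Finset.sum_nonneg fun y _ => hterm T y
  let cfg : Finset (Site d) → Fin 2 → Config d := fun S v =>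
    Function.update (S.piecewise 0 ω) x v
  have hcfg : ∀ S ⊆ U, ∀ v, ∀ z ∉ B, cfg S v z = ω z := by
    intro S hS v z hz
    have hzx : z ≠ x := by rintro rfl; exact hz (by simp [hB])
    have hzS : z ∉ S := fun h => hz (by simp [hB, hS h])
    simp [cfg, Function.update_of_ne hzx, hzS]
  -- Take a largest set that can be emptied at a cost of at most `G` per site, for both values at
  -- `x` simultaneously.
  obtain ⟨S, hS, hmax⟩ := Finset.exists_max_image
    {S ∈ U.powerset | ∀ v, |f (cfg S v) - f (cfg ∅ v)| ≤ S.card * G} Finset.card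
    ⟨∅, by simp⟩
  obtain ⟨hSU, hSG⟩ : S ⊆ U ∧ ∀ v, |f (cfg S v) - f (cfg ∅ v)| ≤ S.card * G := by
    simpa using hS
  -- Maximality leaves nothing to empty: otherwise some site outside `S` would have the required
  -- empty neighbours and could be added to `S`. This update is legal for either value at `x`,
  -- because the neighbours used lie in `U`, which omits `x`.
  have hempty : ∀ z, Emptied Finset.univ (U : Set (Site d)) ω z →
      (S.piecewise 0 ω : Config d) z = 0 := by
    intro z hz
    induction hz with
    | @of_eq_zero y hy h => by_cases hyS : y ∈ S <;> simp [hyS, h]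
    | @step y hy s hs h ih =>
      by_cases hyS : y ∈ S
      · simp [hyS]
      exfalso
      have hyU : y ∈ U := hy
      have hyx : y ≠ x := by rintro rfl; exact hx hyU
      have hnew : ∀ v, cfg (insert y S) v = Function.update (cfg S v) y 0 := by
        intro v
        simp only [cfg]
        rw [Finset.piecewise_insert, Function.update_comm hyx]
        rfl
      have hmem : insert y S ∈
          {S ∈ U.powerset | ∀ v, |f (cfg S v) - f (cfg ∅ v)| ≤ S.card * G} := by
        simp only [Finset.mem_filter, Finset.mem_powerset]
        refine ⟨Finset.insert_subset hyU hSU, fun v => ?_⟩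
        have hc : cfg S v ∈ constraintEvent (modifiedBasic d) y := by
          refine mem_constraintEvent_modifiedBasic hs fun i => ?_
          have hne : y + Pi.single i (s i) ≠ x := by
            intro he
            have := (h i (Finset.mem_univ i)).mem
            rw [he] at this
            exact hx this
          simp only [cfg, Function.update_of_ne hne]
          exact ih i (Finset.mem_univ i)
        have h1 := (abs_update_zero_sub_le y f (cfg S v)).trans
          (hle _ (hcfg S hSU v) y (by simp [hB, hyU]) hc)
        rw [hnew, Finset.card_insert_of_notMem hyS]
        push_cast
        calc _ ≤ |f (Function.update (cfg S v) y 0) - f (cfg S v)| +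
              |f (cfg S v) - f (cfg ∅ v)| := abs_sub_le _ _ _
          _ ≤ _ := by linarith [hSG v]
      have := hmax _ hmem
      rw [Finset.card_insert_of_notMem hyS] at this
      omega
  have hc : cfg S 0 ∈ constraintEvent (modifiedBasic d) x := by
    refine mem_constraintEvent_modifiedBasic (s := fun _ => 1) (fun _ => Or.inr rfl) fun i => ?_
    have hne : x + Pi.single i 1 ≠ x := by simp
    simp only [cfg, Function.update_of_ne hne]
    exact hempty _ (hω i)
  have h1 := hle _ (hcfg S hSU 0) x (by simp [hB]) hc
  have h2 : grad x f (cfg S 0) = f (cfg S 1) - f (cfg S 0) := by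
    simp [grad, cfg]
  have h3 : grad x f ω = f (cfg ∅ 1) - f (cfg ∅ 0) := by
    simp [grad, cfg]
  have h4 : (S.card : ℝ) * G ≤ U.card * G :=
    mul_le_mul_of_nonneg_right (by exact_mod_cast Finset.card_le_card hSU) hG0
  rw [h2] at h1
  rw [h3]
  -- The path empties `S` with `x` at `0`, flips `x`, then restores `S` with `x` at `1`: at most `2
  -- |U| + 1` legal updates, each costing at most `G`.
  have h5 := abs_le.1 (hSG 0)
  have h6 := abs_le.1 (hSG 1)
  have h7 := abs_le.1 h1
  rw [abs_le]
  constructor <;> linarith [h5.1, h5.2, h6.1, h6.2, h7.1, h7.2]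

/-- Cauchy–Schwarz applied to the double sum over the `2 ^ (|U| + 1)` fillings and the `|U| + 1`
sites; the constraint, being `0` or `1`, equals its square. -/
lemma sq_grad_le_sum {U : Finset (Site d)} {x : Site d} (hx : x ∉ U) {ω : Config d}
    (hω : ∀ i, Emptied Finset.univ U ω (x + Pi.single i 1)) (f : Config d → ℝ) :
    grad x f ω ^ 2 ≤ (2 * U.card + 1) ^ 2 * (2 ^ (U.card + 1) * (U.card + 1)) *
      ∑ T ∈ (insert x U).powerset, ∑ y ∈ insert x U,
      constraint (modifiedBasic d) y (refill (insert x U) T ω) *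
        grad y f (refill (insert x U) T ω) ^ 2 := by
  have h := abs_grad_le_sum hx hω f
  rw [← sq_abs, mul_assoc]
  refine (pow_le_pow_left₀ (abs_nonneg _) h 2).trans ?_
  rw [mul_pow]
  refine mul_le_mul_of_nonneg_left ?_ (by positivity)
  refine sq_sum_le_card_mul_sum_sq.trans ?_
  rw [Finset.card_powerset, Finset.card_insert_of_notMem hx, mul_assoc]
  push_cast
  refine mul_le_mul_of_nonneg_left ?_ (by positivity)
  rw [Finset.mul_sum]
  refine Finset.sum_le_sum fun T _ => sq_sum_le_card_mul_sum_sq.trans ?_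
  rw [Finset.card_insert_of_notMem hx]
  push_cast
  simp only [mul_pow, constraint_sq, sq_abs]
  exact le_rfl

/-- Each prescribed value in `B` has probability at least `κ`, so a given filling has probability at
least `κ ^ |B|`, and a nonnegative function is at least its contribution from that filling. -/
lemma pow_mul_refill_le {p κ : ℝ} (hκ : 0 ≤ κ) (hκp : κ ≤ p) (hκp' : κ ≤ 1 - p)
    (B T : Finset (Site d)) {h : Config d → ℝ} (hh : 0 ≤ h) (ω : Config d) :
    κ ^ B.card * h (refill B T ω) ≤ avgSet p B h ω := by
  induction B using Finset.induction_on generalizing ω with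
  | empty => simp [refill]
  | insert a B ha ih =>
    have h0 := avgSet_nonneg (p := p) (by linarith) (by linarith) B hh
    have hv : ∀ v : Fin 2, κ * avgSet p B h (Function.update ω a v) ≤ avgSet p (insert a B) h ω := by
      intro v
      rw [avgSet_insert, avg_apply]
      have h1 := h0 (Function.update ω a 0)
      have h2 := h0 (Function.update ω a 1)
      simp only [Pi.zero_apply] at h1 h2
      have h3 : 0 ≤ p := by linarith
      have h4 : 0 ≤ 1 - p := by linarith
      fin_cases v
      · change κ * avgSet p B h (Function.update ω a 0) ≤ _
        nlinarith [mul_nonneg h4 h2, mul_nonneg (sub_nonneg.2 hκp) h1]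
      · change κ * avgSet p B h (Function.update ω a 1) ≤ _
        nlinarith [mul_nonneg h3 h1, mul_nonneg (sub_nonneg.2 hκp') h2]
    have hr : refill (insert a B) T ω =
        refill B T (Function.update ω a (if a ∈ T then 0 else 1)) := by
      rw [refill, refill, Finset.piecewise_insert, Finset.update_piecewise_of_notMem (hi := ha)]
    rw [Finset.card_insert_of_notMem ha, pow_succ', mul_assoc, hr]
    exact (mul_le_mul_of_nonneg_left (ih _) hκ).trans (hv _)

/-- The long-range constraint at `x`: the sites `x + e_i` can be emptied inside `U`. -/
def emptiedEvent (U : Finset (Site d)) (x : Site d) : Set (Config d) :=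
  {ω | ∀ i, Emptied Finset.univ U ω (x + Pi.single i 1)}

/-- Comparison of the Dirichlet form of the long-range constraint with that of the modified basic
model. -/
lemma avgSet_emptiedEvent_le {p κ : ℝ} (hκ : 0 < κ) (hκp : κ ≤ p) (hκp' : κ ≤ 1 - p)
    {U Λ : Finset (Site d)} {x : Site d} (hx : x ∉ U) (hUΛ : insert x U ⊆ Λ) (f : Config d → ℝ) :
    avgSet p Λ (fun ω => (emptiedEvent U x).indicator 1 ω * grad x f ω ^ 2) 0 ≤
      (2 * U.card + 1) ^ 2 * (2 ^ (U.card + 1) * (U.card + 1)) *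
      (2 ^ (U.card + 1) * (κ ^ (U.card + 1))⁻¹) * ∑ y ∈ insert x U,
        avgSet p Λ (fun ω => constraint (modifiedBasic d) y ω * grad y f ω ^ 2) 0 := by
  have hp0 : 0 ≤ p := by linarith
  have hp1 : p ≤ 1 := by linarith
  set B := insert x U with hB
  have hBcard : B.card = U.card + 1 := Finset.card_insert_of_notMem hx
  set K : ℝ := (2 * U.card + 1) ^ 2 * (2 ^ (U.card + 1) * (U.card + 1)) with hK
  have hK0 : 0 ≤ K := by positivity
  have hκB : 0 < κ ^ (U.card + 1) := by positivity
  set e : Site d → Config d → ℝ := fun y ω => constraint (modifiedBasic d) y ω * grad y f ω ^ 2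
  have he : ∀ y, 0 ≤ e y := fun y ω => mul_nonneg (constraint_nonneg _ _ _) (sq_nonneg _)
  -- The pointwise path bound involves the energies at refilled configurations; each is dominated by
  -- an average over `B`, which the average over `Λ ⊇ B` then absorbs. The extra factor `2 ^ (|U| +
  -- 1)` counts the fillings.
  have hpt : (fun ω => (emptiedEvent U x).indicator 1 ω * grad x f ω ^ 2) ≤
      (K * (2 ^ (U.card + 1) * (κ ^ (U.card + 1))⁻¹)) • ∑ y ∈ B, avgSet p B (e y) := by
    intro ω
    have hrhs : ∀ y, 0 ≤ avgSet p B (e y) ω := fun y => avgSet_nonneg hp0 hp1 B (he y) ω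
    simp only [Pi.smul_apply, Finset.sum_apply, smul_eq_mul]
    by_cases hω : ω ∈ emptiedEvent U x
    · rw [Set.indicator_of_mem hω, Pi.one_apply, one_mul, mul_assoc]
      refine (sq_grad_le_sum hx hω f).trans (mul_le_mul_of_nonneg_left ?_ hK0)
      have hT : ∀ T ∈ B.powerset, ∑ y ∈ B, e y (refill B T ω) ≤
          (κ ^ (U.card + 1))⁻¹ * ∑ y ∈ B, avgSet p B (e y) ω := by
        intro T _
        rw [Finset.mul_sum]
        refine Finset.sum_le_sum fun y _ => ?_
        rw [le_inv_mul_iff₀ hκB, ← hBcard]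
        exact pow_mul_refill_le hκ.le hκp hκp' B T (he y) ω
      refine (Finset.sum_le_sum hT).trans ?_
      rw [Finset.sum_const, Finset.card_powerset, hBcard, nsmul_eq_mul, mul_assoc]
      push_cast
      exact le_rfl
    · rw [Set.indicator_of_notMem hω, zero_mul]
      exact mul_nonneg (by positivity) (Finset.sum_nonneg fun y _ => hrhs y)
  refine (avgSet_mono hp0 hp1 Λ hpt 0).trans_eq ?_
  simp only [map_smul, map_sum, Pi.smul_apply, Finset.sum_apply, smul_eq_mul, avgSet_avgSet,
    Finset.union_eq_left.2 hUΛ]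
  rfl

end KCSM

/-! ### Deterministic growth of emptied cubes -/

namespace KCSM

variable {d : ℕ}

/-- The cube of side `n` with lowest corner `x`, extending in the directions of `I` only. -/
noncomputable def cube (I : Finset (Fin d)) (n : ℕ) (x : Site d) : Finset (Site d) :=
  Fintype.piFinset fun i => if i ∈ I then Finset.Ico (x i) (x i + n) else {x i}

lemma mem_cube {I : Finset (Fin d)} {n : ℕ} {x z : Site d} :
    z ∈ cube I n x ↔ ∀ i, (i ∈ I → x i ≤ z i ∧ z i < x i + n) ∧ (i ∉ I → z i = x i) := by
  rw [cube, Fintype.mem_piFinset]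
  refine forall_congr' fun i => ?_
  by_cases hi : i ∈ I <;> simp [hi]

lemma card_cube (I : Finset (Fin d)) (n : ℕ) (x : Site d) :
    (cube I n x).card = n ^ I.card := by
  rw [cube, Fintype.card_piFinset]
  have h : ∀ i, (if i ∈ I then Finset.Ico (x i) (x i + n) else {x i}).card =
      if i ∈ I then n else 1 := fun i => by split_ifs <;> simp
  simp only [h]
  rw [Finset.prod_ite_mem, Finset.univ_inter, Finset.prod_const]

lemma self_mem_cube {I : Finset (Fin d)} {n : ℕ} (hn : 0 < n) (x : Site d) : x ∈ cube I n x :=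
  mem_cube.2 fun i => ⟨fun _ => ⟨le_rfl, by omega⟩, fun _ => rfl⟩

/-- The bootstrap dynamics in the directions of `I` inside the cube empties the whole cube. -/
def Spanned (I : Finset (Fin d)) (n : ℕ) (x : Site d) (ω : Config d) : Prop :=
  ∀ z ∈ cube I n x, Emptied I (cube I n x : Set (Site d)) ω z

/-- The neighbour in direction `i` is supplied by the emptied region beside `F`, so on `F` only the
directions of `I.erase i` still have to be provided. -/
lemma Emptied.of_face {I : Finset (Fin d)} {i : Fin d} {F U : Set (Site d)} {ω : Config d}
    (hFU : F ⊆ U) {σ : ℤ} (hσ : σ = -1 ∨ σ = 1)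
    (hF : ∀ z ∈ F, Emptied I U ω (z + Pi.single i σ)) {z : Site d}
    (hz : Emptied (I.erase i) F ω z) : Emptied I U ω z := by
  classical
  induction hz with
  | of_eq_zero hy h => exact .of_eq_zero (hFU hy) h
  | @step y hy s hs _ ih =>
    refine .step (hFU hy) (Function.update s i σ) (fun j => ?_) fun j hj => ?_
    · rcases eq_or_ne j i with rfl | hji
      · simpa using hσ
      · simpa [Function.update_of_ne hji] using hs j
    · rcases eq_or_ne j i with rfl | hji
      · simpa using hF y hy
      · simpa [Function.update_of_ne hji] using ih j (Finset.mem_erase.2 ⟨hji, hj⟩)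

/-- An emptied cube can be moved by one step in a direction in which the new face is spanned. -/
lemma emptied_move {I : Finset (Fin d)} {i : Fin d} (hi : i ∈ I) {n : ℕ} (hn : 0 < n)
    {U : Set (Site d)} {ω : Config d} {y y' w : Site d} {σ : ℤ} (hσ : σ = -1 ∨ σ = 1)
    (hy' : ∀ j, j ≠ i → y' j = y j) (hw : ∀ j, j ≠ i → w j = y j)
    (hyi : y' i = y i - σ) (hwi : w i = if σ = -1 then y i + n else y i - 1)
    (hcube : ∀ z ∈ cube I n y, Emptied I U ω z)
    (hFU : (cube (I.erase i) n w : Set (Site d)) ⊆ U) (hF : Spanned (I.erase i) n w ω) :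
    ∀ z ∈ cube I n y', Emptied I U ω z := by
  intro z hz
  by_cases hzy : z ∈ cube I n y
  · exact hcube z hzy
  -- The moved cube has a single layer outside the old one, namely the face at `w`; `σ` points from
  -- that face back to the emptied cube.
  have hzF : z ∈ cube (I.erase i) n w := by
    rw [mem_cube] at hz ⊢
    intro j
    rcases eq_or_ne j i with rfl | hji
    · refine ⟨fun h => absurd h (by simp), fun _ => ?_⟩
      by_contra hne
      refine hzy (mem_cube.2 fun l => ?_)
      rcases eq_or_ne l j with rfl | hlj
      · refine ⟨fun _ => ?_, fun h => absurd hi h⟩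
        have := (hz l).1 hi
        rcases hσ with rfl | rfl <;> simp at hwi <;> omega
      · rw [← hy' l hlj]
        exact hz l
    · rw [hw j hji, ← hy' j hji]
      simpa [hji] using hz j
  refine Emptied.of_face hFU hσ (fun z hz => hcube _ (mem_cube.2 fun j => ?_)) (hF z hzF)
  have hzj := mem_cube.1 hz j
  rcases eq_or_ne j i with rfl | hji
  · refine ⟨fun _ => ?_, fun h => absurd hi h⟩
    have h1 := hzj.2 (by simp)
    simp only [Pi.add_apply, Pi.single_eq_same]
    rcases hσ with rfl | rfl <;> simp at hwi <;> omega
  · rw [hw j hji] at hzj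
    simpa [hji] using hzj

/-- An emptied cube spreads inside a larger cube all of whose faces away from it are spanned. -/
lemma emptied_of_faces {I : Finset (Fin d)} {n N : ℕ} (hn : 0 < n) (hnN : n ≤ N)
    {x y₀ : Site d} (hy₀ : ∀ i, (i ∈ I → x i ≤ y₀ i ∧ y₀ i + n ≤ x i + N) ∧ (i ∉ I → y₀ i = x i))
    {ω : Config d} (hnuc : ∀ z ∈ cube I n y₀, Emptied I (cube I N x : Set (Site d)) ω z)
    (hfaces : ∀ i ∈ I, ∀ w, cube (I.erase i) n w ⊆ cube I N x →
      Disjoint (cube (I.erase i) n w) (cube I n y₀) → Spanned (I.erase i) n w ω) :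
    Spanned I N x ω := by
  classical
  -- Induction on the `ℓ¹` distance from `y₀`: the cube at `y` is reached from the one at `y'`, a
  -- step closer to `y₀`. The new face lies on the side away from `y₀`, hence is disjoint from the
  -- nucleus.
  have key : ∀ k : ℕ, ∀ y : Site d,
      (∀ i, (i ∈ I → x i ≤ y i ∧ y i + n ≤ x i + N) ∧ (i ∉ I → y i = x i)) →
      ∑ i, (y i - y₀ i).natAbs = k →
      ∀ z ∈ cube I n y, Emptied I (cube I N x : Set (Site d)) ω z := by
    intro k
    induction k using Nat.strong_induction_on with
    | _ k ih =>
    intro y hy hk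
    by_cases hyy : y = y₀
    · rw [hyy]; exact hnuc
    obtain ⟨i, hi⟩ := Function.ne_iff.1 hyy
    have hiI : i ∈ I := by
      by_contra h
      exact hi (by rw [(hy i).2 h, (hy₀ i).2 h])
    obtain ⟨σ, hσ, hσi⟩ : ∃ σ : ℤ, (σ = -1 ∨ σ = 1) ∧
        ((σ = -1 ∧ y₀ i < y i) ∨ (σ = 1 ∧ y i < y₀ i)) := by
      rcases lt_or_gt_of_ne hi with h | h
      · exact ⟨1, Or.inr rfl, Or.inr ⟨rfl, h⟩⟩
      · exact ⟨-1, Or.inl rfl, Or.inl ⟨rfl, h⟩⟩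
    set y' : Site d := Function.update y i (y i + σ) with hy'
    have hy'i : y' i = y i + σ := by simp [hy']
    have hy'j : ∀ j, j ≠ i → y' j = y j := fun j hj => by simp [hy', hj]
    set w : Site d := Function.update y i (if σ = -1 then y' i + n else y' i - 1) with hw
    have hwi : w i = if σ = -1 then y' i + n else y' i - 1 := by simp [hw]
    have hwj : ∀ j, j ≠ i → w j = y j := fun j hj => by simp [hw, hj]
    have hlt : ∑ j, (y' j - y₀ j).natAbs < k := by
      rw [← hk]
      refine Finset.sum_lt_sum (fun j _ => ?_) ⟨i, Finset.mem_univ i, ?_⟩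
      · rcases eq_or_ne j i with rfl | hji
        · omega
        · rw [hy'j j hji]
      · omega
    have hcube := ih _ hlt y' (fun j => by
      rcases eq_or_ne j i with rfl | hji
      · have h1 := (hy j).1 hiI
        have h2 := (hy₀ j).1 hiI
        exact ⟨fun _ => by omega, fun h => absurd hiI h⟩
      · rw [hy'j j hji]
        exact hy j) rfl
    have hwi' : (σ = -1 ∧ w i = y i - 1 + n) ∨ (σ = 1 ∧ w i = y i) := by
      rcases hσ with rfl | rfl <;> simp at hwi <;> omega
    have hFU : cube (I.erase i) n w ⊆ cube I N x := by
      intro z hz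
      rw [mem_cube] at hz ⊢
      intro j
      rcases eq_or_ne j i with rfl | hji
      · refine ⟨fun _ => ?_, fun h => absurd hiI h⟩
        have h1 := (hz j).2 (by simp)
        have h2 := (hy j).1 hiI
        omega
      · have h1 := hz j
        rw [hwj j hji] at h1
        have h2 := hy j
        refine ⟨fun hj => ?_, fun hj => ?_⟩
        · have := h1.1 (by simp [hji, hj])
          have := h2.1 hj
          omega
        · rw [h1.2 (by simp [hj]), h2.2 hj]
    refine emptied_move hiI hn hσ (fun j hj => (hy'j j hj).symm)
      (fun j hj => by rw [hwj j hj, hy'j j hj]) (by omega) hwi hcube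
      (by exact_mod_cast hFU) (hfaces i hiI w hFU ?_)
    rw [Finset.disjoint_left]
    intro z hz hz₀
    have h1 := (mem_cube.1 hz i).2 (by simp)
    have h2 := (mem_cube.1 hz₀ i).1 hiI
    omega
  intro z hz
  rw [mem_cube] at hz
  -- A corner of a cube of side `n` that contains `z`, pushed back where needed to stay inside the
  -- large cube.
  refine key _ (fun i => min (z i) (x i + N - n)) (fun i => ?_) rfl z (mem_cube.2 fun i => ?_)
  · refine ⟨fun hi => ?_, fun hi => ?_⟩
    · have := (hz i).1 hi
      omega
    · have h := (hz i).2 hi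
      omega
  · refine ⟨fun hi => ?_, fun hi => ?_⟩
    · have := (hz i).1 hi
      omega
    · have h := (hz i).2 hi
      omega

end KCSM

/-! ### Probability of spanning: independence and union bounds -/

namespace KCSM

variable {d : ℕ}

lemma dependsOn_indicator {s : Set (Config d)} {S : Set (Site d)}
    (hs : DependsOn (· ∈ s) S) : DependsOn (s.indicator (1 : Config d → ℝ)) S := by
  classical
  intro ω ω' h
  have := hs h
  simp only [eq_iff_iff] at this
  simp [Set.indicator_apply, this]

lemma measurableSet_of_dependsOn {s : Set (Config d)} {S : Finset (Site d)}
    (hs : DependsOn (· ∈ s) (S : Set (Site d))) : MeasurableSet s :=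
  (measurable_indicator_const_iff (1 : ℝ)).1
    (IsLocal.measurable ⟨S, dependsOn_indicator hs⟩)

lemma dependsOn_compl {s : Set (Config d)} {S : Set (Site d)} (hs : DependsOn (· ∈ s) S) :
    DependsOn (· ∈ sᶜ) S := fun ω ω' h => by
  have := hs h
  simp only [Set.mem_compl_iff, this]

lemma dependsOn_spanned (I : Finset (Fin d)) (n : ℕ) (x : Site d) :
    DependsOn (· ∈ {ω | Spanned I n x ω}) (cube I n x : Set (Site d)) := by
  have key : ∀ ω ω' : Config d, (∀ i ∈ (cube I n x : Set (Site d)), ω i = ω' i) →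
      Spanned I n x ω → Spanned I n x ω' := fun ω ω' h hs z hz =>
    (hs z hz).mono subset_rfl fun y hy h0 => by rw [← h y hy, h0]
  intro ω ω' h
  exact propext ⟨key ω ω' h, key ω' ω fun i hi => (h i hi).symm⟩

variable {q : unitInterval}

lemma measureReal_eq_avgSet {s : Set (Config d)} {S T : Finset (Site d)} (hST : S ⊆ T)
    (hs : DependsOn (· ∈ s) (S : Set (Site d))) (ω : Config d) :
    avgSet q T (s.indicator 1) ω = (configMeasure d q).real s := by
  rw [avgSet_eq_integral hST (dependsOn_indicator hs),
    integral_indicator_one (measurableSet_of_dependsOn hs)]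

/-- Events that depend on disjoint sets of sites are independent. -/
lemma measureReal_inter_of_disjoint {s t : Set (Config d)} {S T : Finset (Site d)}
    (hs : DependsOn (· ∈ s) (S : Set (Site d))) (ht : DependsOn (· ∈ t) (T : Set (Site d)))
    (hST : Disjoint S T) :
    (configMeasure d q).real (s ∩ t) =
      (configMeasure d q).real s * (configMeasure d q).real t := by
  have h1 : (s ∩ t).indicator (1 : Config d → ℝ) = t.indicator 1 * s.indicator 1 := by
    rw [Set.inter_indicator_one, mul_comm]
  have hms := measurableSet_of_dependsOn hs
  have hmt := measurableSet_of_dependsOn ht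
  have hst : DependsOn (t.indicator (1 : Config d → ℝ) * s.indicator 1)
      ((S ∪ T : Finset (Site d)) : Set (Site d)) := fun ω ω' h => by
    simp only [Pi.mul_apply]
    rw [dependsOn_indicator hs fun i hi => h i (by simp_all),
      dependsOn_indicator ht fun i hi => h i (by simp_all)]
  rw [← integral_indicator_one (hms.inter hmt), h1, ← integral_avgSet S ⟨_, hst⟩,
    avgSet_mul_of_dependsOn (dependsOn_indicator ht) fun x hx hxT =>
      Finset.disjoint_left.1 hST hx (by simpa using hxT)]
  simp only [Pi.mul_apply, measureReal_eq_avgSet subset_rfl hs]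
  rw [integral_mul_const, integral_indicator_one hmt, mul_comm]

/-- All the faces of side `n` of the cube that avoid `K` are spanned. -/
def facesSpanned (I : Finset (Fin d)) (n N : ℕ) (x : Site d) (K : Finset (Site d)) :
    Set (Config d) :=
  {ω | ∀ i ∈ I, ∀ w, cube (I.erase i) n w ⊆ cube I N x → Disjoint (cube (I.erase i) n w) K →
    Spanned (I.erase i) n w ω}

lemma dependsOn_facesSpanned (I : Finset (Fin d)) (n N : ℕ) (x : Site d) (K : Finset (Site d)) :
    DependsOn (· ∈ facesSpanned I n N x K) ((cube I N x \ K : Finset (Site d)) : Set (Site d)) := by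
  intro ω ω' h
  have key : ∀ i w, cube (I.erase i) n w ⊆ cube I N x → Disjoint (cube (I.erase i) n w) K →
      (Spanned (I.erase i) n w ω ↔ Spanned (I.erase i) n w ω') := fun i w h1 h2 =>
    iff_of_eq (dependsOn_spanned (I.erase i) n w fun y hy => h y (by
      simp only [Finset.coe_sdiff, Set.mem_sdiff, Finset.mem_coe]
      exact ⟨h1 hy, Finset.disjoint_left.1 h2 hy⟩))
  simp only [facesSpanned, Set.mem_ofPred_eq, eq_iff_iff]
  refine forall₂_congr fun i _ => forall_congr' fun w => ?_
  refine forall₂_congr fun h1 h2 => key i w h1 h2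

/-- Union bound over the direction and the lowest corner of the face; the corner itself lies in the
large cube, which leaves at most `N ^ |I|` choices. -/
lemma measureReal_compl_facesSpanned_le {I : Finset (Fin d)} {n N : ℕ} (hn : 0 < n) {x : Site d}
    (K : Finset (Site d)) {ρ : ℝ}
    (hρ : ∀ i ∈ I, ∀ w, (configMeasure d q).real {ω | Spanned (I.erase i) n w ω}ᶜ ≤ ρ) :
    (configMeasure d q).real (facesSpanned I n N x K)ᶜ ≤ I.card * N ^ I.card * ρ := by
  have hsub : (facesSpanned I n N x K)ᶜ ⊆
      ⋃ a ∈ I ×ˢ cube I N x, {ω | Spanned (I.erase a.1) n a.2 ω}ᶜ := by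
    intro ω hω
    simp only [facesSpanned, Set.mem_compl_iff, Set.mem_ofPred_eq, not_forall] at hω
    obtain ⟨i, hi, w, h1, _, h3⟩ := hω
    refine Set.mem_biUnion (x := (i, w)) ?_ h3
    exact Finset.mem_coe.2 (Finset.mem_product.2 ⟨hi, h1 (self_mem_cube hn w)⟩)
  refine (measureReal_mono hsub (measure_ne_top _ _)).trans ?_
  refine (measureReal_biUnion_finset_le _ _).trans ?_
  refine (Finset.sum_le_card_nsmul _ _ ρ fun a ha => hρ a.1 (Finset.mem_product.1 ha).1 a.2).trans ?_
  rw [Finset.card_product, card_cube, nsmul_eq_mul]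
  push_cast
  exact le_rfl

lemma measureReal_compl_eq {s : Set (Config d)} {S : Finset (Site d)}
    (hs : DependsOn (· ∈ s) (S : Set (Site d))) :
    (configMeasure d q).real sᶜ = 1 - (configMeasure d q).real s :=
  probReal_compl_eq_one_sub (measurableSet_of_dependsOn hs)

/-- Growth from a cube in the corner. -/
lemma le_measureReal_spanned_of_corner {I : Finset (Fin d)} {n N : ℕ} (hn : 0 < n) (hnN : n ≤ N)
    (x : Site d) {ρ : ℝ}
    (hρ : ∀ i ∈ I, ∀ w, (configMeasure d q).real {ω | Spanned (I.erase i) n w ω}ᶜ ≤ ρ) :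
    (configMeasure d q).real {ω | Spanned I n x ω} * (1 - I.card * N ^ I.card * ρ) ≤
      (configMeasure d q).real {ω | Spanned I N x ω} := by
  have hcube : cube I n x ⊆ cube I N x := fun z hz => by
    rw [mem_cube] at hz ⊢
    exact fun i => ⟨fun hi => ⟨((hz i).1 hi).1, by have := (hz i).1 hi; omega⟩, (hz i).2⟩
  have hF := measureReal_compl_facesSpanned_le (q := q) (N := N) (x := x) hn (cube I n x) hρ
  rw [measureReal_compl_eq (dependsOn_facesSpanned I n N x _)] at hF
  calc _ ≤ (configMeasure d q).real {ω | Spanned I n x ω} *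
        (configMeasure d q).real (facesSpanned I n N x (cube I n x)) :=
      mul_le_mul_of_nonneg_left (by linarith) measureReal_nonneg
    _ = (configMeasure d q).real ({ω | Spanned I n x ω} ∩ facesSpanned I n N x (cube I n x)) :=
      -- Only faces avoiding the nucleus are required, so the two events depend on disjoint sets of
      -- sites and their probabilities multiply. A union bound would be useless here, as spanning
      -- the nucleus may be very unlikely.
      (measureReal_inter_of_disjoint (dependsOn_spanned I n x) (dependsOn_facesSpanned I n N x _)
        Finset.disjoint_sdiff).symm
    _ ≤ _ := by
      refine measureReal_mono ?_ (measure_ne_top _ _)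
      rintro ω ⟨h1, h2⟩
      refine emptied_of_faces hn hnN (y₀ := x) (fun i => ⟨fun _ => ⟨le_rfl, by omega⟩, fun _ => rfl⟩)
        (fun z hz => (h1 z hz).mono (by exact_mod_cast hcube) fun _ _ h => h) h2

/-- The cubes are placed end to end in direction `i`, hence disjoint, so their failures are
independent. -/
lemma measureReal_inter_not_spanned_le {I : Finset (Fin d)} {i : Fin d} (hi : i ∈ I) {n : ℕ}
    (x : Site d) {β : ℝ} (hβ : ∀ y, β ≤ (configMeasure d q).real {ω | Spanned I n y ω}) (k : ℕ) :
    (configMeasure d q).real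
      {ω | ∀ j < k, ¬ Spanned I n (x + Pi.single i ((j * n : ℕ) : ℤ)) ω} ≤ (1 - β) ^ k := by
  have hβ1 : β ≤ 1 := (hβ x).trans measureReal_le_one
  have hdep : ∀ k : ℕ, DependsOn
      (· ∈ {ω : Config d | ∀ j < k, ¬ Spanned I n (x + Pi.single i ((j * n : ℕ) : ℤ)) ω})
      (((Finset.range k).biUnion fun j => cube I n (x + Pi.single i ((j * n : ℕ) : ℤ)) :
        Finset (Site d)) : Set (Site d)) := by
    intro k ω ω' h
    simp only [Set.mem_ofPred_eq, eq_iff_iff]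
    refine forall₂_congr fun j hj => not_congr (iff_of_eq (dependsOn_spanned I n _ fun y hy =>
      h y ?_))
    simp only [Finset.coe_biUnion, Set.mem_iUnion]
    exact ⟨j, by simpa using hj, hy⟩
  induction k with
  | zero => simp
  | succ k ih =>
    have hset : {ω : Config d | ∀ j < k + 1,
          ¬ Spanned I n (x + Pi.single i ((j * n : ℕ) : ℤ)) ω} =
        {ω | ∀ j < k, ¬ Spanned I n (x + Pi.single i ((j * n : ℕ) : ℤ)) ω} ∩
          {ω | Spanned I n (x + Pi.single i ((k * n : ℕ) : ℤ)) ω}ᶜ := by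
      ext ω
      simp only [Set.mem_ofPred_eq, Set.mem_inter_iff, Set.mem_compl_iff]
      exact Nat.forall_lt_succ_right
    rw [hset, measureReal_inter_of_disjoint (hdep k) (dependsOn_compl (dependsOn_spanned I n _)),
      measureReal_compl_eq (dependsOn_spanned I n _), pow_succ]
    · have h1 := hβ (x + Pi.single i ((k * n : ℕ) : ℤ))
      have h2 : (configMeasure d q).real
        {ω | Spanned I n (x + Pi.single i ((k * n : ℕ) : ℤ)) ω} ≤ 1 := measureReal_le_one
      exact mul_le_mul ih (by linarith) (by linarith) (pow_nonneg (by linarith) _)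
    · rw [Finset.disjoint_biUnion_left]
      intro j hj
      rw [Finset.disjoint_left]
      intro z h1 h2
      have h1 := (mem_cube.1 h1 i).1 hi
      have h2 := (mem_cube.1 h2 i).1 hi
      simp only [Pi.add_apply, Pi.single_eq_same] at h1 h2
      have hjk : j + 1 ≤ k := Finset.mem_range.1 hj
      have : (j + 1) * n ≤ k * n := Nat.mul_le_mul_right n hjk
      rw [add_mul, one_mul] at this
      omega

/-- Growth from a cube anywhere. -/
lemma measureReal_not_spanned_le {I : Finset (Fin d)} (hI : I.Nonempty) {n : ℕ} (hn : 0 < n)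
    (x : Site d) {ρ : ℝ}
    (hρ : ∀ i ∈ I, ∀ w, (configMeasure d q).real {ω | Spanned (I.erase i) n w ω}ᶜ ≤ ρ)
    {β : ℝ} (hβ : ∀ y, β ≤ (configMeasure d q).real {ω | Spanned I n y ω}) :
    (configMeasure d q).real {ω | Spanned I (n * n) x ω}ᶜ ≤
      (1 - β) ^ n + I.card * ((n * n : ℕ) : ℝ) ^ I.card * ρ := by
  obtain ⟨i, hi⟩ := hI
  have hnn : n ≤ n * n := Nat.le_mul_self n
  refine le_trans (measureReal_mono (s₂ := {ω | ∀ j < n,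
    ¬ Spanned I n (x + Pi.single i ((j * n : ℕ) : ℤ)) ω} ∪ (facesSpanned I n (n * n) x ∅)ᶜ)
    ?_ (measure_ne_top _ _)) ?_
  · intro ω hω
    by_contra hc
    simp only [Set.mem_union, Set.mem_ofPred_eq, Set.mem_compl_iff, not_or, not_forall,
      not_not] at hc
    obtain ⟨⟨j, hj, hs⟩, hf⟩ := hc
    have hjn : (j + 1) * n ≤ n * n := Nat.mul_le_mul_right n hj
    rw [add_mul, one_mul] at hjn
    have hpos : ∀ l, (l ∈ I → x l ≤ (x + Pi.single i ((j * n : ℕ) : ℤ) : Site d) l ∧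
        (x + Pi.single i ((j * n : ℕ) : ℤ) : Site d) l + n ≤ x l + (n * n : ℕ)) ∧
        (l ∉ I → (x + Pi.single i ((j * n : ℕ) : ℤ) : Site d) l = x l) := by
      intro l
      rcases eq_or_ne l i with rfl | hli
      · simp only [Pi.add_apply, Pi.single_eq_same]
        exact ⟨fun _ => by omega, fun h => absurd hi h⟩
      · simp only [Pi.add_apply, Pi.single_eq_of_ne hli, add_zero]
        exact ⟨fun _ => by omega, fun _ => trivial⟩
    refine hω (emptied_of_faces hn hnn hpos (fun z hz => (hs z hz).mono ?_ fun _ _ h => h)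
      fun l hl w h1 _ => hf l hl w h1 (Finset.disjoint_empty_right _))
    intro z hz
    rw [Finset.mem_coe, mem_cube] at hz ⊢
    intro l
    refine ⟨fun hl => ?_, fun hl => ?_⟩
    · have := (hz l).1 hl
      have := (hpos l).1 hl
      omega
    · rw [(hz l).2 hl, (hpos l).2 hl]
  · refine (measureReal_union_le _ _).trans (add_le_add ?_ ?_)
    · exact measureReal_inter_not_spanned_le hi x hβ n
    · exact measureReal_compl_facesSpanned_le hn ∅ hρ

/-- A completely empty cube is spanned. -/
lemma pow_le_measureReal_spanned {κ : ℝ} (hκ : 0 ≤ κ) (hκq : κ ≤ q) (hκq' : κ ≤ 1 - q)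
    (I : Finset (Fin d)) (n : ℕ) (x : Site d) :
    κ ^ n ^ I.card ≤ (configMeasure d q).real {ω | Spanned I n x ω} := by
  have h := pow_mul_refill_le hκ hκq hκq' (cube I n x) (cube I n x)
    (h := {ω | Spanned I n x ω}.indicator 1) (Set.indicator_nonneg fun _ _ => zero_le_one) 0
  rw [measureReal_eq_avgSet subset_rfl (dependsOn_spanned I n x), card_cube,
    Set.indicator_of_mem, Pi.one_apply, mul_one] at h
  · exact h
  · intro z hz
    refine .of_eq_zero hz ?_
    simp [refill, hz]

end KCSM

/-! ### Bootstrap percolation by iteration over scales -/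

namespace KCSM

variable {d : ℕ}

/-- The doubly exponential sequence of the sides of the cubes. -/
def side (k : ℕ) : ℕ := 2 ^ 2 ^ k

lemma side_pos (k : ℕ) : 0 < side k := by unfold side; positivity

lemma side_succ (k : ℕ) : side (k + 1) = side k * side k := by
  rw [side, side, ← pow_add, pow_succ, mul_two]

lemma tendsto_side : Filter.Tendsto side Filter.atTop Filter.atTop := by
  have h : Filter.Tendsto (fun k : ℕ => 2 ^ k) Filter.atTop Filter.atTop :=
    tendsto_pow_atTop_atTop_of_one_lt one_lt_two
  exact h.comp h

lemma eventually_le_side (c : ℕ) : ∀ᶠ k in Filter.atTop, c ≤ side k :=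
  tendsto_side.eventually_ge_atTop c

lemma two_pow_succ_le_side_sq (k : ℕ) : 2 ^ (k + 2) ≤ side k ^ 2 := by
  rw [sq, ← side_succ, side]
  exact Nat.pow_le_pow_right two_pos Nat.lt_two_pow_self

variable {q : unitInterval}

/-- The probability that a cube of side `side k` is not spanned decays faster than any power of its
side. -/
def FastDecay (q : unitInterval) (I : Finset (Fin d)) : Prop :=
  ∀ m : ℕ, ∀ᶠ k in Filter.atTop, ∀ x : Site d,
    (configMeasure d q).real {ω | Spanned I (side k) x ω}ᶜ ≤ ((side k : ℝ) ^ m)⁻¹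

/-- If the faces are very likely to be spanned, cubes of all large sides are spanned with uniformly
positive probability. -/
lemma exists_le_measureReal_spanned (hq0 : 0 < q) (hq1 : q < 1) {I : Finset (Fin d)}
    (hI : ∀ i ∈ I, FastDecay q (I.erase i)) :
    ∃ β : ℝ, 0 < β ∧ ∀ᶠ k in Filter.atTop, ∀ x : Site d,
      β ≤ (configMeasure d q).real {ω | Spanned I (side k) x ω} := by
  -- Of the exponent, `2 |I|` pays for the number of faces at scale `k + 1`, one unit for the factor
  -- `|I|`, and two for the summable error `2 ^ -(k + 2)`.
  have h1 : ∀ᶠ k in Filter.atTop, ∀ i ∈ I, ∀ x : Site d, (configMeasure d q).real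
      {ω | Spanned (I.erase i) (side k) x ω}ᶜ ≤ ((side k : ℝ) ^ (2 * I.card + 3))⁻¹ :=
    (Filter.eventually_all_finset I).2 fun i hi => hI i hi _
  obtain ⟨k₀, hk₀⟩ := Filter.eventually_atTop.1 (h1.and (eventually_le_side I.card))
  have hq0' : (0 : ℝ) < q := hq0
  have hq1' : (q : ℝ) < 1 := hq1
  set κ : ℝ := min q (1 - q) with hκ
  have hκ0 : 0 < κ := lt_min hq0' (by linarith)
  set β₀ := κ ^ side k₀ ^ I.card with hβ₀
  have hβ₀pos : 0 < β₀ := by positivity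
  -- The factor decreasing to `1 / 2` absorbs the losses: with `a = 2 ^ -(k + 1) ≤ 1 / 2` and loss
  -- at most `a / 2`, `(1 / 2 + a) (1 - a / 2) ≥ 1 / 2 + a / 2`.
  have key : ∀ k, k₀ ≤ k → ∀ x : Site d, β₀ * (1 / 2 + (1 / 2) ^ (k + 1)) ≤
      (configMeasure d q).real {ω | Spanned I (side k) x ω} := by
    intro k hk
    induction k, hk using Nat.le_induction with
    | base =>
      intro x
      have h := pow_le_measureReal_spanned hκ0.le (min_le_left _ _) (min_le_right _ _) I (side k₀) x
      have h2 : ((1 : ℝ) / 2) ^ (k₀ + 1) ≤ 1 / 2 := by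
        rw [pow_succ]
        have : ((1 : ℝ) / 2) ^ k₀ ≤ 1 := pow_le_one₀ (by norm_num) (by norm_num)
        linarith
      refine le_trans ?_ h
      nlinarith
    | succ k hk ih =>
      intro x
      obtain ⟨hρ, hcard⟩ := hk₀ k hk
      have hs : (0 : ℝ) < side k := by exact_mod_cast side_pos k
      have hgrow := le_measureReal_spanned_of_corner (side_pos k)
        (Nat.le_mul_self (side k)) x hρ
      rw [← side_succ] at hgrow
      refine le_trans ?_ hgrow
      have hε : (I.card : ℝ) * (side (k + 1) : ℝ) ^ I.card * ((side k : ℝ) ^ (2 * I.card + 3))⁻¹ ≤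
          (1 / 2) ^ (k + 2) := by
        have hc : (I.card : ℝ) ≤ side k := by exact_mod_cast hcard
        have h2 : (2 : ℝ) ^ (k + 2) ≤ (side k : ℝ) ^ 2 := by
          exact_mod_cast two_pow_succ_le_side_sq k
        rw [side_succ]
        push_cast
        rw [← sq, ← pow_mul, ← div_eq_mul_inv, div_le_iff₀ (by positivity), one_div, inv_pow,
          le_inv_mul_iff₀ (by positivity)]
        calc (2 : ℝ) ^ (k + 2) * (I.card * side k ^ (2 * I.card)) ≤
            side k ^ 2 * (side k * side k ^ (2 * I.card)) := by gcongr
          _ = _ := by ring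
      have hih := ih x
      have ha : (0 : ℝ) < (1 / 2) ^ (k + 1) := by positivity
      have ha1 : ((1 : ℝ) / 2) ^ (k + 1) ≤ 1 / 2 := by
        rw [pow_succ]
        have : ((1 : ℝ) / 2) ^ k ≤ 1 := pow_le_one₀ (by norm_num) (by norm_num)
        linarith
      have ha2 : ((1 : ℝ) / 2) ^ (k + 2) = (1 / 2) ^ (k + 1) / 2 := by rw [pow_succ]; ring
      have ha3 : ((1 : ℝ) / 2) ^ (k + 1 + 1) = (1 / 2) ^ (k + 1) / 2 := by rw [pow_succ]; ring
      rw [ha2] at hε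
      rw [ha3]
      set a := ((1 : ℝ) / 2) ^ (k + 1)
      set ε := (I.card : ℝ) * (side (k + 1) : ℝ) ^ I.card * ((side k : ℝ) ^ (2 * I.card + 3))⁻¹
      have hε1 : 0 ≤ 1 - ε := by linarith
      calc β₀ * (1 / 2 + a / 2) ≤ β₀ * ((1 / 2 + a) * (1 - ε)) := by
            refine mul_le_mul_of_nonneg_left ?_ hβ₀pos.le
            nlinarith
        _ = β₀ * (1 / 2 + a) * (1 - ε) := by ring
        _ ≤ _ := mul_le_mul_of_nonneg_right hih hε1
  refine ⟨β₀ / 2, by positivity, Filter.eventually_atTop.2 ⟨k₀, fun k hk x => ?_⟩⟩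
  refine le_trans ?_ (key k hk x)
  have ha : (0 : ℝ) < (1 / 2) ^ (k + 1) := by positivity
  nlinarith

/-- A cube of side `n²` holds `n` disjoint possible nuclei of side `n`, each spanned with
probability at least `β`. All fail with probability at most `(1 - β) ^ n`, exponentially small in
`n`, and the unspanned faces cost less than any power of `n`. -/
lemma FastDecay.of_faces (hq0 : 0 < q) (hq1 : q < 1) {I : Finset (Fin d)} (hne : I.Nonempty)
    (hI : ∀ i ∈ I, FastDecay q (I.erase i)) : FastDecay q I := by
  intro m
  obtain ⟨β, hβ0, hβ⟩ := exists_le_measureReal_spanned hq0 hq1 hI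
  -- Since `side (k + 1)` is the square of `side k`, the face count uses `2 |I|` and the target
  -- power `2 m`; the spare unit beats `2 |I|`, leaving half of the target.
  have h1 : ∀ᶠ k in Filter.atTop, ∀ i ∈ I, ∀ x : Site d, (configMeasure d q).real
      {ω | Spanned (I.erase i) (side k) x ω}ᶜ ≤ ((side k : ℝ) ^ (2 * I.card + 2 * m + 1))⁻¹ :=
    (Filter.eventually_all_finset I).2 fun i hi => hI i hi _
  have h2 : ∀ᶠ k in Filter.atTop, (side k : ℝ) ^ (2 * m) * (1 - min β 1) ^ side k < 1 / 2 := by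
    have h0 : |1 - min β 1| < 1 := by
      rw [abs_lt]
      have := lt_min hβ0 one_pos
      have := min_le_right β 1
      constructor <;> linarith
    exact ((tendsto_pow_const_mul_const_pow_of_abs_lt_one (2 * m) h0).comp
      tendsto_side).eventually (gt_mem_nhds (by norm_num))
  obtain ⟨k₀, hk₀⟩ := Filter.eventually_atTop.1
    (((hβ.and h1).and h2).and (eventually_le_side (2 * I.card)))
  refine Filter.eventually_atTop.2 ⟨k₀ + 1, fun k hk x => ?_⟩
  obtain ⟨k, rfl⟩ : ∃ l, k = l + 1 := ⟨k - 1, by omega⟩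
  obtain ⟨⟨⟨hβk, hρ⟩, hsmall⟩, hcard⟩ := hk₀ k (by omega)
  have hs : (0 : ℝ) < side k := by exact_mod_cast side_pos k
  have hc : 2 * (I.card : ℝ) ≤ side k := by exact_mod_cast hcard
  have hmain := measureReal_not_spanned_le hne (side_pos k) x hρ
    (β := min β 1) fun y => (min_le_left _ _).trans (hβk y)
  rw [← side_succ] at hmain
  refine hmain.trans ?_
  have hface : (I.card : ℝ) * (side (k + 1) : ℝ) ^ I.card *
      ((side k : ℝ) ^ (2 * I.card + 2 * m + 1))⁻¹ ≤ ((side (k + 1) : ℝ) ^ m)⁻¹ * (1 / 2) := by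
    rw [side_succ]
    push_cast
    rw [← sq, ← pow_mul, ← pow_mul, ← div_eq_mul_inv, div_le_iff₀ (by positivity), mul_assoc,
      le_inv_mul_iff₀ (by positivity)]
    calc (side k : ℝ) ^ (2 * m) * (I.card * side k ^ (2 * I.card)) =
        1 / 2 * ((2 * I.card) * side k ^ (2 * I.card + 2 * m)) := by ring
      _ ≤ 1 / 2 * (side k * side k ^ (2 * I.card + 2 * m)) := by gcongr
      _ = _ := by ring
  have hnuc : (1 - min β 1) ^ side k ≤ ((side (k + 1) : ℝ) ^ m)⁻¹ * (1 / 2) := by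
    rw [le_inv_mul_iff₀ (by have := side_pos (k + 1); positivity), side_succ]
    push_cast
    rw [← sq, ← pow_mul]
    exact hsmall.le
  linarith

/-- Bootstrap percolation of the modified basic model: large cubes are spanned with overwhelming
probability, in every dimension and at every density. -/
theorem fastDecay (hq0 : 0 < q) (hq1 : q < 1) (I : Finset (Fin d)) : FastDecay q I := by
  induction I using Finset.strongInduction with
  | H I ih =>
    rcases I.eq_empty_or_nonempty with rfl | hne
    · intro m
      refine Filter.Eventually.of_forall fun k x => ?_
      have h : {ω : Config d | Spanned ∅ (side k) x ω}ᶜ = ∅ := by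
        rw [Set.compl_empty_iff, Set.eq_univ_iff_forall]
        -- With no active direction the rule has no premises, so every site is emptied.
        exact fun ω z hz => .step hz (fun _ => 1) (fun _ => Or.inr rfl) (by simp)
      rw [h, measureReal_empty]
      positivity
    · exact .of_faces hq0 hq1 hne fun i hi => ih _ (Finset.erase_ssubset hi)

end KCSM

/-! ### Poincaré inequality of the modified basic model -/

namespace KCSM

variable {d : ℕ} {q : unitInterval}

/-- The sites of the cube of side `L + 1` above `x`, other than `x`. -/
noncomputable def punctured (L : ℕ) (x : Site d) : Finset (Site d) :=
  (cube Finset.univ (L + 1) x).erase x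

lemma insert_punctured (L : ℕ) (x : Site d) :
    insert x (punctured L x) = cube Finset.univ (L + 1) x :=
  Finset.insert_erase (self_mem_cube L.succ_pos x)

lemma notMem_punctured (L : ℕ) (x : Site d) : x ∉ punctured L x :=
  Finset.notMem_erase x _

lemma card_punctured (L : ℕ) (x : Site d) : (punctured L x).card = (L + 1) ^ d - 1 := by
  rw [punctured, Finset.card_erase_of_mem (self_mem_cube L.succ_pos x), card_cube,
    Finset.card_univ, Fintype.card_fin]

/-- This is the orientation: a point coordinatewise above `x` and distinct from it is
lexicographically later. -/
lemma toLex_lt_of_mem_punctured {L : ℕ} {x z : Site d} (hz : z ∈ punctured L x) :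
    toLex x < toLex z := by
  rw [punctured, Finset.mem_erase, mem_cube] at hz
  exact Pi.toLex_strictMono
    (lt_of_le_of_ne (fun i => ((hz.2 i).1 (Finset.mem_univ i)).1) hz.1.symm)

lemma cube_subset_punctured (L : ℕ) (x : Site d) (i : Fin d) :
    cube Finset.univ L (x + Pi.single i 1) ⊆ punctured L x := by
  intro z hz
  rw [mem_cube] at hz
  rw [punctured, Finset.mem_erase, mem_cube]
  constructor
  · rintro rfl
    have := ((hz i).1 (Finset.mem_univ i)).1
    simp at this
  · intro j
    refine ⟨fun hj => ?_, fun hj => absurd (Finset.mem_univ j) hj⟩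
    have := (hz j).1 hj
    rcases eq_or_ne j i with rfl | hji
    · simp only [Pi.add_apply, Pi.single_eq_same] at this
      push_cast
      omega
    · simp only [Pi.add_apply, Pi.single_eq_of_ne hji, add_zero] at this
      push_cast
      omega

lemma dependsOn_emptiedEvent (U : Finset (Site d)) (x : Site d) :
    DependsOn (· ∈ emptiedEvent U x) (U : Set (Site d)) := by
  have key : ∀ ω ω' : Config d, (∀ i ∈ (U : Set (Site d)), ω i = ω' i) →
      ω ∈ emptiedEvent U x → ω' ∈ emptiedEvent U x := fun ω ω' h hs i =>
    (hs i).mono subset_rfl fun y hy h0 => by rw [← h y hy, h0]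
  intro ω ω' h
  exact propext ⟨key ω ω' h, key ω' ω fun i hi => (h i hi).symm⟩

/-- It suffices that the `d` cubes of side `L` with corners `x + e_i` be spanned: they lie in the
punctured cube, and each contains its own corner. -/
lemma measureReal_compl_emptiedEvent_le {L : ℕ} (hL : 0 < L) {ρ : ℝ}
    (hρ : ∀ x : Site d, (configMeasure d q).real {ω | Spanned Finset.univ L x ω}ᶜ ≤ ρ)
    (x : Site d) : (configMeasure d q).real (emptiedEvent (punctured L x) x)ᶜ ≤ d * ρ := by
  have hsub : (emptiedEvent (punctured L x) x)ᶜ ⊆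
      ⋃ i ∈ (Finset.univ : Finset (Fin d)),
        {ω | Spanned Finset.univ L (x + Pi.single i 1) ω}ᶜ := by
    intro ω hω
    simp only [emptiedEvent, Set.mem_compl_iff, Set.mem_ofPred_eq, not_forall] at hω
    obtain ⟨i, hi⟩ := hω
    refine Set.mem_biUnion (x := i) (by simp) fun hs => hi ?_
    exact (hs _ (self_mem_cube hL _)).mono
      (by exact_mod_cast cube_subset_punctured L x i) fun _ _ h => h
  refine (measureReal_mono hsub (measure_ne_top _ _)).trans ?_
  refine (measureReal_biUnion_finset_le _ _).trans ?_
  refine (Finset.sum_le_card_nsmul _ _ ρ fun i _ => hρ _).trans ?_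
  rw [Finset.card_univ, Fintype.card_fin, nsmul_eq_mul]

/-- There is a scale at which the long-range constraints fail rarely. -/
lemma exists_rare_scale (hq0 : 0 < q) (hq1 : q < 1) : ∃ (L : ℕ) (ε : ℝ), 0 ≤ ε ∧
    ε * ((L + 1) ^ d : ℕ) ≤ 1 / 4 ∧
    ∀ x : Site d, (configMeasure d q).real (emptiedEvent (punctured L x) x)ᶜ ≤ ε := by
  -- The decay exponent `d + 1` exceeds the volume exponent by one: failure probability times volume
  -- is at most `d 2 ^ d / side k`, made at most `1 / 4` by the size condition.
  obtain ⟨k, hk, hc⟩ := ((fastDecay hq0 hq1 (Finset.univ : Finset (Fin d)) (d + 1)).and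
    (eventually_le_side (4 * (d * 2 ^ d)))).exists
  have hs : (0 : ℝ) < side k := by exact_mod_cast side_pos k
  refine ⟨side k, d * ((side k : ℝ) ^ (d + 1))⁻¹, by positivity, ?_, fun x =>
    measureReal_compl_emptiedEvent_le (side_pos k) hk x⟩
  have h1 : ((side k : ℝ) + 1) ^ d ≤ (2 * side k) ^ d := by
    have : (1 : ℝ) ≤ side k := by exact_mod_cast side_pos k
    gcongr
    linarith
  have h2 : (4 : ℝ) * (d * 2 ^ d) ≤ side k := by exact_mod_cast hc
  push_cast
  rw [← div_eq_mul_inv, div_mul_eq_mul_div, div_le_iff₀ (by positivity)]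
  calc (d : ℝ) * (side k + 1) ^ d ≤ d * (2 * side k) ^ d := by gcongr
    _ = 1 / 4 * (4 * (d * 2 ^ d) * side k ^ d) := by rw [mul_pow]; ring
    _ ≤ 1 / 4 * (side k * side k ^ d) := by gcongr
    _ = _ := by ring

lemma dependsOn_grad {f : Config d → ℝ} {S : Set (Site d)} (hf : DependsOn f S) (x : Site d) :
    DependsOn (grad x f) S := by
  have key : ∀ v (ω ω' : Config d), (∀ i ∈ S, ω i = ω' i) →
      f (Function.update ω x v) = f (Function.update ω' x v) := fun v ω ω' h => hf fun i hi => by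
    rcases eq_or_ne i x with rfl | hix
    · simp
    · simp [Function.update_of_ne hix, h i hi]
  intro ω ω' h
  rw [grad, grad, key 1 ω ω' h, key 0 ω ω' h]

lemma dependsOn_constraint {C : InfluenceClasses d} {x : Site d} {S : Set (Site d)}
    (hC : ∀ A ∈ C x, (A : Set (Site d)) ⊆ S) : DependsOn (constraint C x) S := by
  refine dependsOn_indicator fun ω ω' h => ?_
  simp only [constraintEvent, Set.mem_ofPred_eq, eq_iff_iff]
  refine exists_congr fun A => and_congr_right fun hA => forall₂_congr fun y hy => ?_
  rw [h y (hC A hA hy)]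

lemma abs_sub_avg_le {p : ℝ} (hp0 : 0 ≤ p) (hp1 : p ≤ 1) (x : Site d) (f : Config d → ℝ)
    (ω : Config d) : |f ω - avg p x f ω| ≤ |grad x f ω| := by
  have h : ω x = 0 ∨ ω x = 1 := by omega
  rcases h with h | h
  · have h0 : Function.update ω x 0 = ω := by rw [← h, Function.update_eq_self]
    have : f ω - avg p x f ω = -((1 - p) * grad x f ω) := by
      rw [avg_apply, grad, h0]; ring
    rw [this, abs_neg, abs_mul, abs_of_nonneg (by linarith : (0 : ℝ) ≤ 1 - p)]
    exact mul_le_of_le_one_left (abs_nonneg _) (by linarith)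
  · have h0 : Function.update ω x 1 = ω := by rw [← h, Function.update_eq_self]
    have : f ω - avg p x f ω = p * grad x f ω := by
      rw [avg_apply, grad, h0]; ring
    rw [this, abs_mul, abs_of_nonneg hp0]
    exact mul_le_of_le_one_left (abs_nonneg _) hp1

/-- Averaging a function restricted to an unlikely event of the averaged sites. -/
lemma avgFamily_normSq_proj_mul_le (hp0 : (0 : ℝ) ≤ q) (hp1 : (q : ℝ) ≤ 1)
    {S Λ U : Finset (Site d)} (hS : S ⊆ Λ) (hU : U ⊆ S) {s : Set (Config d)}
    (hs : DependsOn (· ∈ s) (U : Set (Site d))) {ε : ℝ}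
    (hε : (configMeasure d q).real s ≤ ε) (u : Config d → ℝ) :
    (avgFamily hp0 hp1 Λ).normSq ((avgFamily hp0 hp1 Λ).proj S
      (LinearMap.mulLeft ℝ (s.indicator 1) u)) ≤ ε * (avgFamily hp0 hp1 Λ).normSq u := by
  set g : Config d → ℝ := s.indicator 1
  change avgSet q Λ (avgSet q S (g * u) * avgSet q S (g * u)) 0 ≤ ε * avgSet q Λ (u * u) 0
  have hgg : g * g = g := by
    funext ω
    by_cases hω : ω ∈ s <;> simp [g, hω]
  have h1 : avgSet q S (g * u) * avgSet q S (g * u) ≤ ε • avgSet q S (u * u) := by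
    intro ω
    -- As `g` is an indicator depending only on sites of `S`, Cauchy–Schwarz produces the average of
    -- `g² = g`, which is the probability of the event.
    have h2 := avgSet_mul_sq_le hp0 hp1 S g u ω
    rw [hgg, measureReal_eq_avgSet hU hs] at h2
    have h3 := avgSet_nonneg hp0 hp1 S (f := u * u) (fun ω => mul_self_nonneg _) ω
    rw [sq] at h2
    exact h2.trans (mul_le_mul_of_nonneg_right hε h3)
  refine (avgSet_mono hp0 hp1 Λ h1 0).trans_eq ?_
  rw [map_smul, avgSet_avgSet, Finset.union_eq_left.2 hS]
  rfl

/-- The Poincaré inequality for the long-range constraints. -/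
lemma avgSet_sq_le_sum_emptiedEvent {L : ℕ} {ε : ℝ} (hε0 : 0 ≤ ε)
    (hεL : ε * ((L + 1) ^ d : ℕ) ≤ 1 / 4)
    (hε : ∀ x : Site d, (configMeasure d q).real (emptiedEvent (punctured L x) x)ᶜ ≤ ε)
    {Λ₀ Λ : Finset (Site d)} (hΛ : ∀ x ∈ Λ₀, cube Finset.univ (L + 1) x ⊆ Λ)
    {F : Config d → ℝ} (hF : DependsOn F (Λ₀ : Set (Site d))) :
    avgSet q Λ ((F - avgSet q Λ F) * (F - avgSet q Λ F)) 0 ≤ 4 * ∑ x ∈ Λ₀,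
      avgSet q Λ (fun ω => (emptiedEvent (punctured L x) x).indicator 1 ω * grad x F ω ^ 2) 0 := by
  have hp0 : (0 : ℝ) ≤ q := q.2.1
  have hp1 : (q : ℝ) ≤ 1 := q.2.2
  have hΛ₀ : Λ₀ ⊆ Λ := fun x hx => hΛ x hx (self_mem_cube L.succ_pos x)
  have hΔ : ∀ x ∈ Λ₀, punctured L x ⊆ Λ := fun x hx => (Finset.erase_subset _ _).trans (hΛ x hx)
  have main := (avgFamily_selfAdjointOn hp0 hp1 Λ).poincare (key := fun x : Site d => toLex x)
    toLex.injective hΛ₀ (Δ := punctured L) hΔ (fun x z hz => toLex_lt_of_mem_punctured hz)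
    (M := fun x => LinearMap.mulLeft ℝ ((emptiedEvent (punctured L x) x)ᶜ.indicator 1))
    (fun x T hT => by
      refine LinearMap.ext fun u => ?_
      exact (avgSet_mul_of_dependsOn
        (dependsOn_indicator (dependsOn_compl (dependsOn_emptiedEvent _ x)))
        (fun y hy hy' => Finset.disjoint_left.1 hT hy hy') u).symm)
    hε0 (m := (L + 1) ^ d) (ε := ε) (v := F) ?_ ?_ hεL ?_
  · refine main.trans (mul_le_mul_of_nonneg_left (Finset.sum_le_sum fun x hx => ?_) (by norm_num))
    refine avgSet_mono hp0 hp1 Λ ?_ 0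
    intro ω
    have hQ : ((avgFamily hp0 hp1 Λ).compl x F) ω = F ω - avg q x F ω := by
      simp only [ProjectionFamily.compl, LinearMap.sub_apply, Module.End.one_apply, Pi.sub_apply]
      change F ω - avgSet q {x} F ω = _
      rw [avgSet_singleton]
    simp only [Pi.mul_apply, Pi.sub_apply, LinearMap.mulLeft_apply, hQ]
    by_cases hω : ω ∈ emptiedEvent (punctured L x) x
    · simp only [Set.indicator_of_mem hω, Set.indicator_of_notMem (fun h => h hω :
        ω ∉ (emptiedEvent (punctured L x) x)ᶜ), Pi.one_apply, zero_mul, sub_zero, one_mul, ← sq]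
      exact sq_le_sq.2 (abs_sub_avg_le hp0 hp1 x F ω)
    · simp [Set.indicator_of_notMem hω, Set.indicator_of_mem (show
        ω ∈ (emptiedEvent (punctured L x) x)ᶜ from hω)]
  · intro x hx u
    exact avgFamily_normSq_proj_mul_le hp0 hp1 (by apply Finset.filter_subset)
      (fun z hz => by
        simp only [Finset.mem_filter]
        exact ⟨hΔ x hx hz, toLex_lt_of_mem_punctured hz⟩)
      (dependsOn_compl (dependsOn_emptiedEvent _ x)) (hε x) u
  · intro z T hT
    -- The sites whose cube contains `z` lie in the reflected cube, whose highest corner is `z`.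
    refine (Finset.card_le_card (t := cube Finset.univ (L + 1) (z - fun _ => (L : ℤ)))
      fun x hx => ?_).trans_eq ?_
    · have h := hT x hx
      rw [insert_punctured, mem_cube] at h
      refine mem_cube.2 fun i => ⟨fun hi => ?_, fun hi => absurd (Finset.mem_univ i) hi⟩
      have := (h i).1 hi
      simp only [Pi.sub_apply]
      push_cast at this ⊢
      omega
    · rw [card_cube, Finset.card_univ, Fintype.card_fin]
  · intro x _ hx₀
    simp only [ProjectionFamily.compl, LinearMap.sub_apply, Module.End.one_apply]
    change F - avgSet q {x} F = 0
    rw [avgSet_eq_self hF (fun y hy => by rw [Finset.mem_singleton.1 hy]; simpa using hx₀),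
      sub_self]

/-- The Poincaré inequality of the modified basic model for local functions. -/
theorem exists_poincare_modifiedBasic (hq0 : 0 < q) (hq1 : q < 1) : ∃ K : ℝ, 0 ≤ K ∧
    ∀ (Λ₀ : Finset (Site d)) (F : Config d → ℝ), DependsOn F (Λ₀ : Set (Site d)) →
      ∃ Λ₁ : Finset (Site d), Λ₀ ⊆ Λ₁ ∧ Var[F; configMeasure d q] ≤ K * ∑ y ∈ Λ₁,
        ∫ ω, constraint (modifiedBasic d) y ω * grad y F ω ^ 2 ∂(configMeasure d q) := by
  obtain ⟨L, ε, hε0, hεL, hε⟩ := exists_rare_scale (d := d) hq0 hq1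
  have hq0' : (0 : ℝ) < q := hq0
  have hq1' : (q : ℝ) < 1 := hq1
  set κ : ℝ := min q (1 - q) with hκ
  have hκ0 : 0 < κ := lt_min hq0' (by linarith)
  set u : ℕ := (L + 1) ^ d - 1
  set K₁ : ℝ := (2 * u + 1) ^ 2 * (2 ^ (u + 1) * (u + 1)) * (2 ^ (u + 1) * (κ ^ (u + 1))⁻¹)
    with hK₁
  have hK₁0 : 0 ≤ K₁ := by positivity
  refine ⟨4 * (K₁ * ((L + 1) ^ d : ℕ)), by positivity, fun Λ₀ F hF => ?_⟩
  set Λ₁ := Λ₀.biUnion fun x => cube Finset.univ (L + 1) x with hΛ₁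
  -- One extra layer on every side, so that the constraints at the sites of `Λ₁` also depend only on
  -- `Λ`, and averages over `Λ` are integrals.
  set Λ := Λ₀.biUnion fun x => cube Finset.univ (L + 3) (x - 1) with hΛ
  have hnear : ∀ y ∈ Λ₁, ∀ z : Site d, (∀ i, |y i - z i| ≤ 1) → z ∈ Λ := by
    intro y hy z hz
    obtain ⟨x, hx, hy⟩ := Finset.mem_biUnion.1 hy
    refine Finset.mem_biUnion.2 ⟨x, hx, mem_cube.2 fun i => ⟨fun hi => ?_, fun hi =>
      absurd (Finset.mem_univ i) hi⟩⟩
    have h1 := (mem_cube.1 hy i).1 hi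
    have h2 := abs_le.1 (hz i)
    simp only [Pi.sub_apply, Pi.one_apply]
    push_cast at h1 ⊢
    omega
  have hΛ₁Λ : Λ₁ ⊆ Λ := fun y hy => hnear y hy y fun i => by simp
  have hcube : ∀ x ∈ Λ₀, cube Finset.univ (L + 1) x ⊆ Λ₁ := fun x hx =>
    Finset.subset_biUnion_of_mem (fun x => cube Finset.univ (L + 1) x) hx
  have hΛ₀ : Λ₀ ⊆ Λ₁ := fun x hx => hcube x hx (self_mem_cube L.succ_pos x)
  refine ⟨Λ₁, hΛ₀, ?_⟩
  have hFΛ : DependsOn F (Λ : Set (Site d)) := hF.mono (by exact_mod_cast hΛ₀.trans hΛ₁Λ)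
  set a : Site d → ℝ := fun y =>
    ∫ ω, constraint (modifiedBasic d) y ω * grad y F ω ^ 2 ∂(configMeasure d q) with ha
  have ha0 : ∀ y, 0 ≤ a y := fun y =>
    integral_nonneg fun ω => mul_nonneg (constraint_nonneg _ _ _) (sq_nonneg _)
  have haΛ : ∀ y ∈ Λ₁,
      avgSet q Λ (fun ω => constraint (modifiedBasic d) y ω * grad y F ω ^ 2) 0 = a y := by
    intro y hy
    refine avgSet_eq_integral subset_rfl (fun ω ω' h => ?_) 0
    have h1 : DependsOn (constraint (modifiedBasic d) y) (Λ : Set (Site d)) := by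
      refine dependsOn_constraint fun A hA z hz => ?_
      refine hnear y hy z fun i => ?_
      have h2 : ∑ i, |y i - z i| = 1 := hA.1 hz
      rw [← h2]
      exact Finset.single_le_sum (f := fun i => |y i - z i|) (fun i _ => abs_nonneg _)
        (Finset.mem_univ i)
    rw [h1 h, dependsOn_grad hFΛ y h]
  have hvar : Var[F; configMeasure d q] =
      avgSet q Λ ((F - avgSet q Λ F) * (F - avgSet q Λ F)) 0 := by
    have hE : avgSet q Λ F = fun _ => ∫ ω, F ω ∂(configMeasure d q) :=
      funext fun ω => avgSet_eq_integral subset_rfl hFΛ ω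
    rw [hE, avgSet_eq_integral (S := Λ) subset_rfl (fun ω ω' h => by simp [hFΛ h]),
      variance_eq_integral (IsLocal.measurable ⟨Λ, hFΛ⟩).aemeasurable]
    simp [sq]
  have hlong := avgSet_sq_le_sum_emptiedEvent hε0 hεL hε (Λ₀ := Λ₀) (Λ := Λ)
    (fun x hx => (hcube x hx).trans hΛ₁Λ) hF
  have hshort : ∀ x ∈ Λ₀, avgSet q Λ
      (fun ω => (emptiedEvent (punctured L x) x).indicator 1 ω * grad x F ω ^ 2) 0 ≤
      K₁ * ∑ y ∈ cube Finset.univ (L + 1) x, a y := by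
    intro x hx
    have h := avgSet_emptiedEvent_le hκ0 (min_le_left _ _) (min_le_right _ _)
      (notMem_punctured L x) (Λ := Λ)
      (by rw [insert_punctured]; exact (hcube x hx).trans hΛ₁Λ) F
    rw [insert_punctured, card_punctured] at h
    refine h.trans_eq ?_
    rw [Finset.sum_congr rfl fun y hy => haΛ y (hcube x hx hy)]
  have hcount : ∑ x ∈ Λ₀, ∑ y ∈ cube Finset.univ (L + 1) x, a y ≤
      ((L + 1) ^ d : ℕ) * ∑ y ∈ Λ₁, a y := by
    rw [Finset.sum_comm' (s' := fun y => {x ∈ Λ₀ | y ∈ cube Finset.univ (L + 1) x}) (t' := Λ₁)]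
    · rw [Finset.mul_sum]
      refine Finset.sum_le_sum fun y _ => ?_
      rw [Finset.sum_const, nsmul_eq_mul]
      refine mul_le_mul_of_nonneg_right ?_ (ha0 y)
      have : {x ∈ Λ₀ | y ∈ cube Finset.univ (L + 1) x} ⊆
          cube Finset.univ (L + 1) (y - fun _ => (L : ℤ)) := by
        intro x hx
        have h := mem_cube.1 (Finset.mem_filter.1 hx).2
        refine mem_cube.2 fun i => ⟨fun hi => ?_, fun hi => absurd (Finset.mem_univ i) hi⟩
        have := (h i).1 hi
        simp only [Pi.sub_apply]
        push_cast at this ⊢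
        omega
      have hc := Finset.card_le_card this
      rw [card_cube, Finset.card_univ, Fintype.card_fin] at hc
      exact_mod_cast hc
    · intro x y
      simp only [Finset.mem_filter]
      exact ⟨fun h => ⟨h, hcube x h.1 h.2⟩, fun h => h.1⟩
  rw [hvar]
  refine hlong.trans ?_
  rw [mul_assoc, mul_assoc]
  refine mul_le_mul_of_nonneg_left ?_ (by norm_num)
  refine (Finset.sum_le_sum hshort).trans ?_
  rw [← Finset.mul_sum]
  exact mul_le_mul_of_nonneg_left hcount hK₁0

end KCSM

/-! ### From local functions to the spectral gap -/

namespace KCSM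

variable {d : ℕ} {q : unitInterval} {C : InfluenceClasses d}

lemma measurableSet_constraintEvent (C : InfluenceClasses d) (x : Site d) :
    MeasurableSet (constraintEvent C x) := by
  have h : constraintEvent C x = ⋃ A ∈ C x, ⋂ y ∈ A, {ω : Config d | ω y = 0} := by
    ext ω
    simp [constraintEvent]
  rw [h]
  refine MeasurableSet.biUnion (Set.to_countable _) fun A _ => ?_
  refine Finset.measurableSet_biInter A fun y _ => ?_
  exact (measurable_pi_apply (X := fun _ : Site d => Fin 2) y) (measurableSet_singleton (0 : Fin 2))

lemma measurable_constraint (C : InfluenceClasses d) (x : Site d) :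
    Measurable (constraint C x) :=
  measurable_one.indicator (measurableSet_constraintEvent C x)

lemma constraint_update (hC : ∀ x, ∀ A ∈ C x, x ∉ A) (x : Site d) (ω : Config d) (v : Fin 2) :
    constraint C x (Function.update ω x v) = constraint C x ω :=
  dependsOn_constraint (S := {x}ᶜ) (fun A hA y hy => by rintro rfl; exact hC _ A hA hy)
    fun i hi => Function.update_of_ne hi _ _

lemma constraint_mul_eq_indicator (x : Site d) (g : Config d → ℝ) :
    (fun ω => constraint C x ω * g ω) = (constraintEvent C x).indicator g := by
  funext ω
  by_cases h : ω ∈ constraintEvent C x <;> simp [constraint, h]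

lemma memLp_grad (hq0 : 0 < q) (hq1 : q < 1) {f : Config d → ℝ} (hf : Measurable f)
    (hf2 : MemLp f 2 (configMeasure d q)) (x : Site d) :
    MemLp (grad x f) 2 (configMeasure d q) := by
  have h : ∀ v, MemLp (fun ω : Config d => f (Function.update ω x v)) 2 (configMeasure d q) :=
    fun v => (memLp_two_iff_integrable_sq
      (hf.comp (measurable_update_const x v)).aestronglyMeasurable).2
      (integrable_update hq0 hq1 x v (hf.pow_const 2) hf2.integrable_sq)
  exact (h 1).sub (h 0)

/-- The contribution of the site `x` to the Dirichlet form, up to the factor `q (1 - q)`. -/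
noncomputable def siteEnergy (C : InfluenceClasses d) (q : unitInterval) (f : Config d → ℝ)
    (x : Site d) : ℝ :=
  ∫ ω, constraint C x ω * grad x f ω ^ 2 ∂(configMeasure d q)

lemma integrable_siteEnergy (hq0 : 0 < q) (hq1 : q < 1) {f : Config d → ℝ} (hf : Measurable f)
    (hf2 : MemLp f 2 (configMeasure d q)) (x : Site d) :
    Integrable (fun ω => constraint C x ω * grad x f ω ^ 2) (configMeasure d q) := by
  rw [constraint_mul_eq_indicator]
  exact (memLp_grad hq0 hq1 hf hf2 x).integrable_sq.indicator (measurableSet_constraintEvent C x)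

lemma localVar_eq (f : Config d → ℝ) (x : Site d) (ω : Config d) :
    localVar q f x ω = ENNReal.ofReal (q * (1 - q) * grad x f ω ^ 2) := by
  have hq0 : (0 : ℝ) ≤ q := q.2.1
  have hq1 : (0 : ℝ) ≤ 1 - q := sub_nonneg.2 q.2.2
  rw [localVar, evariance_eq_lintegral_ofReal, integral_siteMeasure, lintegral_siteMeasure,
    ← ENNReal.ofReal_mul hq0, ← ENNReal.ofReal_mul hq1, ← ENNReal.ofReal_add (by positivity)
      (mul_nonneg hq1 (sq_nonneg _)), grad]
  congr 1
  ring

lemma lintegral_localVar (hq0 : 0 < q) (hq1 : q < 1) {f : Config d → ℝ} (hf : Measurable f)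
    (hf2 : MemLp f 2 (configMeasure d q)) (x : Site d) :
    ∫⁻ ω in constraintEvent C x, localVar q f x ω ∂(configMeasure d q) =
      ENNReal.ofReal (q * (1 - q) * siteEnergy C q f x) := by
  have hq : (0 : ℝ) ≤ q * (1 - q) := mul_nonneg q.2.1 (sub_nonneg.2 q.2.2)
  rw [← lintegral_indicator (measurableSet_constraintEvent C x), siteEnergy, ← integral_const_mul,
    ofReal_integral_eq_lintegral_ofReal ((integrable_siteEnergy hq0 hq1 hf hf2 x).const_mul _)
      (Filter.Eventually.of_forall fun ω => mul_nonneg hq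
        (mul_nonneg (constraint_nonneg _ _ _) (sq_nonneg _)))]
  refine lintegral_congr fun ω => ?_
  by_cases h : ω ∈ constraintEvent C x
  · rw [Set.indicator_of_mem h, localVar_eq, constraint_eq_one h, one_mul]
  · rw [Set.indicator_of_notMem h, constraint, Set.indicator_of_notMem h]
    simp

lemma siteEnergy_nonneg (f : Config d → ℝ) (x : Site d) : 0 ≤ siteEnergy C q f x :=
  integral_nonneg fun _ => mul_nonneg (constraint_nonneg _ _ _) (sq_nonneg _)

lemma sum_siteEnergy_le (hq0 : 0 < q) (hq1 : q < 1) {f : Config d → ℝ} (hf : Measurable f)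
    (hf2 : MemLp f 2 (configMeasure d q)) (hD : dirichletForm C q f ≠ ⊤) (Λ : Finset (Site d)) :
    q * (1 - q) * ∑ x ∈ Λ, siteEnergy C q f x ≤ (dirichletForm C q f).toReal := by
  have hq : (0 : ℝ) ≤ q * (1 - q) := mul_nonneg q.2.1 (sub_nonneg.2 q.2.2)
  rw [Finset.mul_sum]
  refine (ENNReal.ofReal_le_iff_le_toReal hD).1 ?_
  rw [ENNReal.ofReal_sum_of_nonneg fun x _ => mul_nonneg hq (siteEnergy_nonneg f x)]
  simp only [← lintegral_localVar hq0 hq1 hf hf2]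
  exact ENNReal.sum_le_tsum Λ

lemma localGenerator_eq_sum {F : Config d → ℝ} {Λ : Finset (Site d)}
    (hF : DependsOn F (Λ : Set (Site d))) (ω : Config d) :
    localGenerator C q F ω = ∑ x ∈ Λ, constraint C x ω * (avg q x F ω - F ω) := by
  have h : ∀ x, siteGenerator C q F x ω = constraint C x ω * (avg q x F ω - F ω) := fun x => by
    rw [siteGenerator, integral_siteMeasure]; rfl
  simp only [localGenerator, h]
  refine finsum_eq_sum_of_support_subset _ fun x hx => ?_
  by_contra hxΛ
  refine hx ?_
  have h1 : avg q x F = F := by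
    rw [← avgSet_singleton]
    exact avgSet_eq_self hF fun y hy => by rwa [Finset.mem_singleton.1 hy]
  simp [h1]

/-- Integration by parts for the generator on local functions. -/
lemma integral_mul_localGenerator (hC : ∀ x, ∀ A ∈ C x, x ∉ A)
    {f F : Config d → ℝ} (hf : Measurable f) (hf2 : MemLp f 2 (configMeasure d q))
    {Λ : Finset (Site d)} (hF : DependsOn F (Λ : Set (Site d))) :
    ∫ ω, f ω * localGenerator C q F ω ∂(configMeasure d q) = -(q * (1 - q) * ∑ x ∈ Λ,
      ∫ ω, constraint C x ω * (grad x f ω * grad x F ω) ∂(configMeasure d q)) := by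
  have hFl : IsLocal F := ⟨Λ, hF⟩
  have hterm : ∀ x, Integrable (fun ω => f ω * (constraint C x ω * (avg q x F ω - F ω)))
      (configMeasure d q) := by
    intro x
    have h1 : IsLocal (avg q x F) := by
      rw [← avgSet_singleton]
      exact hFl.avgSet _ _
    have h2 := ((hf2.integrable_mul ((h1.memLp 2).sub (hFl.memLp 2)))).indicator
      (measurableSet_constraintEvent C x)
    rw [← constraint_mul_eq_indicator] at h2
    refine h2.congr (Filter.Eventually.of_forall fun ω => ?_)
    simp only [Pi.mul_apply, Pi.sub_apply]
    ring
  simp only [localGenerator_eq_sum hF, Finset.mul_sum]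
  rw [integral_finsetSum _ fun x _ => hterm x, ← Finset.sum_neg_distrib]
  refine Finset.sum_congr rfl fun x _ => ?_
  -- Averaging over `ω_x` first turns `f (ν_x F - F)` into `-q (1 - q)` times the product of the two
  -- gradients; the constraint does not see `ω_x`.
  rw [← integral_avg x _ (hterm x), ← integral_const_mul, ← integral_neg]
  · refine integral_congr_ae (Filter.Eventually.of_forall fun ω => ?_)
    simp only [avg_apply, constraint_update hC, Function.update_idem, grad]
    ring
  · refine hf.mul ((measurable_constraint C x).mul (Measurable.sub ?_ hFl.measurable))
    rw [← avgSet_singleton]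
    exact (hFl.avgSet _ _).measurable

lemma neg_integral_mul_localGenerator_self (hC : ∀ x, ∀ A ∈ C x, x ∉ A) {F : Config d → ℝ} {Λ : Finset (Site d)}
    (hF : DependsOn F (Λ : Set (Site d))) :
    -∫ ω, F ω * localGenerator C q F ω ∂(configMeasure d q) =
      q * (1 - q) * ∑ x ∈ Λ, siteEnergy C q F x := by
  have hFl : IsLocal F := ⟨Λ, hF⟩
  rw [integral_mul_localGenerator hC hFl.measurable (hFl.memLp 2) hF, neg_neg]
  simp only [siteEnergy, sq]

/-- By parts the left side is twice a mixed energy, bounded through `2 a b ≤ a² + b²`. The form of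
`f` enters only as a constant, so letting `F` tend to `f` in the graph norm gives `-⟨f, 𝓛 f⟩ ≤ 𝓓(f)`
with no convergence of Dirichlet forms. -/
lemma neg_two_mul_integral_mul_localGenerator_le (hq0 : 0 < q) (hq1 : q < 1)
    (hC : ∀ x, ∀ A ∈ C x, x ∉ A) {f F : Config d → ℝ} (hf : Measurable f)
    (hf2 : MemLp f 2 (configMeasure d q)) (hD : dirichletForm C q f ≠ ⊤) (hF : IsLocal F) :
    -(2 * ∫ ω, f ω * localGenerator C q F ω ∂(configMeasure d q)) ≤
      (dirichletForm C q f).toReal - ∫ ω, F ω * localGenerator C q F ω ∂(configMeasure d q) := by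
  obtain ⟨Λ, hΛ⟩ := hF
  have hFl : IsLocal F := ⟨Λ, hΛ⟩
  have hq : (0 : ℝ) ≤ q * (1 - q) := mul_nonneg q.2.1 (sub_nonneg.2 q.2.2)
  rw [sub_eq_add_neg, neg_integral_mul_localGenerator_self hC hΛ,
    integral_mul_localGenerator hC hf hf2 hΛ]
  have h1 := sum_siteEnergy_le hq0 hq1 hf hf2 hD Λ
  have h2 : ∀ x ∈ Λ, 2 * ∫ ω, constraint C x ω * (grad x f ω * grad x F ω) ∂(configMeasure d q) ≤
      siteEnergy C q f x + siteEnergy C q F x := by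
    intro x _
    have hi := integrable_siteEnergy (C := C) hq0 hq1 hf hf2 x
    have hi' := integrable_siteEnergy (C := C) hq0 hq1 hFl.measurable (hFl.memLp 2) x
    have hm : Integrable (fun ω => constraint C x ω * (grad x f ω * grad x F ω))
        (configMeasure d q) := by
      rw [constraint_mul_eq_indicator]
      exact ((memLp_grad hq0 hq1 hf hf2 x).integrable_mul
        (memLp_grad hq0 hq1 hFl.measurable (hFl.memLp 2) x)).indicator
        (measurableSet_constraintEvent C x)
    rw [siteEnergy, siteEnergy, ← integral_add hi hi', ← integral_const_mul]
    refine integral_mono (hm.const_mul 2) (hi.add hi') fun ω => ?_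
    simp only
    nlinarith [mul_nonneg (constraint_nonneg C x ω) (sq_nonneg (grad x f ω - grad x F ω))]
  have h3 := Finset.sum_le_sum h2
  rw [← Finset.mul_sum, Finset.sum_add_distrib] at h3
  have h4 := mul_le_mul_of_nonneg_left h3 hq
  linarith

/-- A Poincaré inequality for local functions bounds the spectral gap from below. -/
theorem spectralGap_pos_of_local (hq0 : 0 < q) (hq1 : q < 1) (hC : ∀ x, ∀ A ∈ C x, x ∉ A)
    {K : ℝ} (hK : 0 < K) (hloc : ∀ F : Config d → ℝ, IsLocal F → Var[F; configMeasure d q] ≤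
      K * -∫ ω, F ω * localGenerator C q F ω ∂(configMeasure d q)) :
    0 < spectralGap C q := by
  refine lt_of_lt_of_le (ENNReal.ofReal_pos.2 (inv_pos.2 hK)) (le_iInf ?_)
  rintro ⟨f, hfdom, hfne⟩
  set μ := configMeasure d q
  have hfm : Measurable (f : Config d → ℝ) := (Lp.stronglyMeasurable f).measurable
  have hf2 : MemLp (f : Config d → ℝ) 2 μ := Lp.memLp f
  have hvar0 : eVar[f; μ] ≠ 0 := fun h =>
    hfne ⟨_, (evariance_eq_zero_iff hfm.aemeasurable).1 h⟩
  rw [ENNReal.le_div_iff_mul_le (Or.inl hvar0) (Or.inl hf2.evariance_ne_top)]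
  by_cases hD : dirichletForm C q f = ⊤
  · rw [hD]; exact le_top
  obtain ⟨p, hp, rfl⟩ : ∃ p ∈ (localGraph C q).topologicalClosure, p.1 = f := by
    simpa [generator, Submodule.toLinearPMap_domain] using hfdom
  obtain ⟨g, hg, hlim⟩ := mem_closure_iff_seq_limit.1 hp
  have hlim1 : Filter.Tendsto (fun n => (g n).1) Filter.atTop (nhds p.1) :=
    (continuous_fst.tendsto p).comp hlim
  have hlim2 : Filter.Tendsto (fun n => (g n).2) Filter.atTop (nhds p.2) :=
    (continuous_snd.tendsto p).comp hlim
  choose F hF hF1 hF2 using hg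
  have hinner : ∀ (u v : L2 d q) (F G : Config d → ℝ), u =ᵐ[μ] F → v =ᵐ[μ] G →
      inner ℝ u v = ∫ ω, F ω * G ω ∂μ := by
    intro u v F G hu hv
    rw [L2.inner_def]
    refine integral_congr_ae ?_
    filter_upwards [hu, hv] with ω h1 h2
    rw [h1, h2]
    simp [mul_comm]
  set one : L2 d q := (memLp_const (1 : ℝ)).toLp
  have hone : one =ᵐ[μ] fun _ => (1 : ℝ) := MemLp.coeFn_toLp _
  have hvareq : ∀ (u : L2 d q) (F : Config d → ℝ), u =ᵐ[μ] F → MemLp F 2 μ →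
      Var[F; μ] = inner ℝ u u - inner ℝ one u ^ 2 := by
    intro u F hu hF
    rw [variance_eq_sub hF, hinner u u F F hu hu, hinner one u _ F hone hu]
    simp [sq]
  -- Variance and `⟨F, 𝓛 F⟩` are continuous in the graph norm, so the local inequality passes to the
  -- limit.
  have hcore1 : inner ℝ p.1 p.1 - inner ℝ one p.1 ^ 2 ≤ K * -inner ℝ p.1 p.2 := by
    have hL := (hlim1.inner (𝕜 := ℝ) hlim1).sub
      (((tendsto_const_nhds (x := one)).inner (𝕜 := ℝ) hlim1).pow 2)
    have hR := (hlim1.inner (𝕜 := ℝ) hlim2).neg.const_mul K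
    refine le_of_tendsto_of_tendsto' hL hR fun n => ?_
    rw [← hvareq _ _ (hF1 n) ((hF n).memLp 2), hinner _ _ _ _ (hF1 n) (hF2 n)]
    exact hloc _ (hF n)
  have hcore2 : -(2 * inner ℝ p.1 p.2) ≤
      (dirichletForm C q p.1).toReal - inner ℝ p.1 p.2 := by
    have hL := (((tendsto_const_nhds (x := p.1)).inner (𝕜 := ℝ) hlim2).const_mul 2).neg
    have hR := (tendsto_const_nhds (x := (dirichletForm C q p.1).toReal)).sub
      (hlim1.inner (𝕜 := ℝ) hlim2)
    refine le_of_tendsto_of_tendsto' hL hR fun n => ?_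
    rw [hinner p.1 _ p.1 _ Filter.EventuallyEq.rfl (hF2 n), hinner _ _ _ _ (hF1 n) (hF2 n)]
    exact neg_two_mul_integral_mul_localGenerator_le hq0 hq1 hC hfm hf2 hD (hF n)
  rw [← hvareq p.1 _ Filter.EventuallyEq.rfl hf2] at hcore1
  have hle : Var[p.1; μ] ≤ K * (dirichletForm C q p.1).toReal :=
    hcore1.trans (mul_le_mul_of_nonneg_left (by linarith) hK.le)
  rw [← hf2.ofReal_variance_eq, ← ENNReal.ofReal_mul (inv_nonneg.2 hK.le),
    ENNReal.ofReal_le_iff_le_toReal hD, inv_mul_le_iff₀ hK]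
  exact hle

lemma notMem_of_subset_neighbors {x : Site d} {A : Finset (Site d)}
    (hA : (A : Set (Site d)) ⊆ neighbors x) : x ∉ A := fun hx => by
  have h : ∑ i, |x i - x i| = 1 := hA hx
  simp at h

/-- The gap is positive for every model constrained no more than the modified basic model. -/
theorem spectralGap_pos (hq0 : 0 < q) (hq1 : q < 1) (hC : ∀ x, ∀ A ∈ C x, x ∉ A)
    (hle : ∀ x, constraintEvent (modifiedBasic d) x ⊆ constraintEvent C x) :
    0 < spectralGap C q := by
  obtain ⟨K, hK0, hK⟩ := exists_poincare_modifiedBasic (d := d) hq0 hq1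
  have hq : (0 : ℝ) < q * (1 - q) := mul_pos hq0 (sub_pos.2 (show (q : ℝ) < 1 from hq1))
  refine spectralGap_pos_of_local hq0 hq1 hC (K := (K + 1) / (q * (1 - q))) (by positivity)
    fun F hF => ?_
  obtain ⟨Λ₀, hΛ₀⟩ := hF
  obtain ⟨Λ₁, hsub, hvar⟩ := hK Λ₀ F hΛ₀
  have hF1 : DependsOn F (Λ₁ : Set (Site d)) := hΛ₀.mono (by exact_mod_cast hsub)
  have hFl : IsLocal F := ⟨Λ₁, hF1⟩
  rw [neg_integral_mul_localGenerator_self hC hF1, ← mul_assoc,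
    div_mul_cancel₀ _ hq.ne']
  refine hvar.trans (mul_le_mul (by linarith) (Finset.sum_le_sum fun x _ => ?_)
    (Finset.sum_nonneg fun x _ => siteEnergy_nonneg F x) (by linarith))
  refine integral_mono (integrable_siteEnergy hq0 hq1 hFl.measurable (hFl.memLp 2) x)
    (integrable_siteEnergy hq0 hq1 hFl.measurable (hFl.memLp 2) x) fun ω => ?_
  exact mul_le_mul_of_nonneg_right
    (Set.indicator_le_indicator_of_subset (hle x) (fun _ => zero_le_one) ω) (sq_nonneg _)

/-- Neighbours chosen in different coordinate directions are distinct. -/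
lemma card_le_of_mem_modifiedBasic {x : Site d} {A : Finset (Site d)}
    (hA : A ∈ modifiedBasic d x) : d ≤ A.card := by
  have h : ∀ i : Fin d, ∃ σ : ℤ, σ ≠ 0 ∧ x + Pi.single i σ ∈ A := fun i => by
    rcases hA.2 i with h | h
    · exact ⟨-1, by norm_num, by rwa [Pi.single_neg, ← sub_eq_add_neg]⟩
    · exact ⟨1, one_ne_zero, h⟩
  choose σ hσ hmem using h
  have hinj : Function.Injective fun i => x + Pi.single i (σ i) := fun i j hij => by
    by_contra hne
    have := congrFun (add_left_cancel hij) i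
    rw [Pi.single_eq_same, Pi.single_eq_of_ne hne] at this
    exact hσ i this
  simpa using Finset.card_le_card_of_injOn (s := Finset.univ) _ (fun i _ => hmem i)
    hinj.injOn

end KCSM

theorem mainTheorem7 (d : ℕ) (hd : 2 ≤ d) (q : unitInterval) (hq0 : 0 < q) (hq1 : q < 1) :
    (∀ j : ℕ, 1 ≤ j → j ≤ d → 0 < KCSM.spectralGap (KCSM.fredricksonAndersen d j) q) ∧
      0 < KCSM.spectralGap (KCSM.modifiedBasic d) q := by
  refine ⟨fun j _ hj => KCSM.spectralGap_pos hq0 hq1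
    (fun x A hA => KCSM.notMem_of_subset_neighbors hA.1) fun x => ?_,
    KCSM.spectralGap_pos hq0 hq1 (fun x A hA => KCSM.notMem_of_subset_neighbors hA.1)
      fun x => subset_rfl⟩
  rintro ω ⟨A, hA, h⟩
  exact ⟨A, ⟨hA.1, hj.trans (KCSM.card_le_of_mem_modifiedBasic hA)⟩, h⟩
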